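/- Let $q$ be a prime power, $\mathbb F=\mathbb F_{q^2}$, and let $R=\mathbb F[X,Y]/(X^{q+1}-Y^q-Y)=\mathbb F[x,y]$ be the coordinate ring of the Hermitian curve, with fraction field $\mathbb F(x,y)$. Every $f\in R$ is uniquely $f=\sum_{a\ge 0,\,0\le b<q}f_{a,b}x^ay^b$; for $f\neq 0$ put $\rho(f)=\max\{aq+b(q+1): f_{a,b}\ne 0\}$. Let $z^*_0=y^{q-1}+1$ and $z^*_b=y^{q-1-b}$ for $1\le b<q$. Let $e=(e_P)$ be any vector with entries in $\mathbb F$ indexed by the $\mathbb F$-rational affine points $P=(\alpha_P,\beta_P)$ of the curve. Put $$I^e=\{f\in R: f(P)=0\text{ whenever }e_P\ne 0\},\qquad S=\sum_P e_P\,\frac{x^{q+1}-\alpha_P^{q+1}}{(x-\alpha_P)(y-\beta_P)}\in\mathbb F(x,y),$$ and $s_{a,b}=\sum_P e_P\alpha_P^a\beta_P^b$ for $a\ge 0$, $s_{a,b}=0$ for $a<0$. Let $\Delta^e=\rho(R\setminus\{0\})\setminus\rho(I^e\setminus\{0\})$, $\sigma_i=\min\{\rho(f):0\ne f\in I^e,\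 \rho(f)\equiv i \bmod q\}$ for $0\le i<q$, $\sigma_{\max}=\max_i\sigma_i$, and $\delta_{\max}=\max\Delta^e$ (with $\delta_{\max}=0$ if $e=0$, when $\Delta^e=\emptyset$). Define $f_i^{(m)},\varphi_i^{(m)},g_i^{(m)},\psi_i^{(m)}\in R$ for $0\le i<q$ and $m\ge 0$ as follows. Initially $f_i^{(0)}=y^i$, $\varphi_i^{(0)}=0$, $g_i^{(0)}=0$, $\psi_i^{(0)}=-z^*_i$. Given the data for $m$, for every ordered pair $(i,j)$ with $0\le i,j<q$ and $i+j\equiv m\bmod q$ set $$d_i=\rho(f_i^{(m)}),\quad d_j=\rho(f_j^{(m)}),\quad r_i=\frac{m-d_i-j(q+1)}{q},\quad p=\frac{d_i+d_j-m}{q}-1,\quad \mu_i=\sum_{c=0}^{q-1}\sum_a (y^jf_i^{(m)})_{a,c}\,s_{a+r_i,c},$$ $$U_i^{(m)}=\begin{pmatrix}1&-\mu_ix^p\\0&1\end{pmatrix}\ \text{if }\mu_i=0\text{ or }p\ge 0,\qquad U_i^{(m)}=\begin{pmatrix}x^{-p}&-\mu_i\\1/\mu_i&0\end{pmatrix}\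 \text{otherwise},$$ $$\begin{pmatrix}f_i^{(m+1)}&\varphi_i^{(m+1)}\\g_j^{(m+1)}&\psi_j^{(m+1)}\end{pmatrix}=U_i^{(m)}\begin{pmatrix}f_i^{(m)}&\varphi_i^{(m)}\\g_j^{(m)}&\psi_j^{(m)}\end{pmatrix}.$$ Then the minima $\sigma_i$ exist for all $i$, and the maximum of $\Delta^e$ exists if $e\neq 0$. For every $m>\sigma_{\max}+\delta_{\max}$, each of the polynomials $f_i^{(m)}$ ($0\le i<q$) belongs to $I^e$. With $M=\sigma_{\max}+\max\{\delta_{\max},\,q^2-q-1\}$, each of the pairs $f_i^{(M+1)},\varphi_i^{(M+1)}$ satisfies the key equation $f_i^{(M+1)}S=\varphi_i^{(M+1)}$. -/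

import Mathlib

namespace Hermitian

open Polynomial

noncomputable section

variable (q : ℕ) (F : Type*) [Field F]

/-- The polynomial `Y ^ q + Y - X ^ (q + 1)` in `F[X][Y]`, whose zeros are the points of the
Hermitian curve. -/
def curvePoly : F[X][X] := X ^ q + X - C (X ^ (q + 1))

/-- The coordinate ring `F[x, y] = F[X, Y] / (X ^ (q + 1) - Y ^ q - Y)`. -/
abbrev CoordRing : Type _ := AdjoinRoot (curvePoly q F)

section Domain

theorem one_lt_of_primePow [hq : Fact (IsPrimePow q)] : 1 < q := hq.out.one_lt

theorem curvePoly_monic [Fact (IsPrimePow q)] : (curvePoly q F).Monic := by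
  have h := one_lt_of_primePow q
  have e : curvePoly q F = X ^ q + (X - C (X ^ (q + 1))) := by
    unfold curvePoly; ring
  rw [e]
  refine monic_X_pow_add ?_
  rw [degree_X_sub_C]
  exact_mod_cast h

theorem curvePoly_irreducible [Fact (IsPrimePow q)] : Irreducible (curvePoly q F) := by
  have h := one_lt_of_primePow q
  -- the same polynomial, up to sign, read in `F[Y][X]`
  let P : F[X][X] := X ^ (q + 1) - C (X ^ q + X)
  have hdeg : P.natDegree = q + 1 := natDegree_X_pow_sub_C
  have hmon : P.Monic := monic_X_pow_sub_C _ (by omega)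
  have hprime : (Ideal.span {(X : F[X])}).IsPrime := by
    rw [Ideal.span_singleton_prime X_ne_zero]
    exact prime_X
  have hE : P.IsEisensteinAt (Ideal.span {(X : F[X])}) := by
    refine ⟨?_, ?_, ?_⟩
    · rw [hmon.leadingCoeff]
      exact fun h1 => hprime.ne_top ((Ideal.eq_top_iff_one _).2 h1)
    · intro n hn
      rw [hdeg] at hn
      rw [Ideal.mem_span_singleton]
      simp only [P, coeff_sub, coeff_X_pow, if_neg hn.ne, coeff_C, zero_sub]
      split_ifs
      · rw [dvd_neg]
        exact dvd_add (dvd_pow_self _ (by omega)) dvd_rfl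
      · simp
    · rw [Ideal.span_singleton_pow, Ideal.mem_span_singleton]
      intro hd
      rw [X_pow_dvd_iff] at hd
      have := hd 1 (by norm_num)
      rw [coeff_sub, coeff_X_pow, if_neg (by omega), coeff_C_zero, zero_sub, coeff_neg, coeff_add,
        coeff_X_pow, if_neg h.ne, coeff_X_one, zero_add] at this
      exact one_ne_zero (neg_eq_zero.1 this)
  have hPirr : Irreducible P := hE.irreducible hprime hmon.isPrimitive (by omega)
  have hswap : curvePoly q F = -(Polynomial.Bivariate.swap (R := F) P) := by
    simp only [P, curvePoly, map_sub, map_add, map_pow, Bivariate.swap_Y,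
      Bivariate.swap_C]
    simp
  rw [hswap, (Associated.refl (Polynomial.Bivariate.swap (R := F) P)).neg_left.irreducible_iff]
  exact (MulEquiv.irreducible_iff (Polynomial.Bivariate.swap (R := F))).2 hPirr

end Domain

instance [Fact (IsPrimePow q)] : IsDomain (CoordRing q F) :=
  AdjoinRoot.isDomain_of_prime (curvePoly_irreducible q F).prime

/-- The function field `F(x, y)` of the curve. -/
abbrev FunField : Type _ := FractionRing (CoordRing q F)

/-- The class of `X` in the coordinate ring. -/
def x : CoordRing q F := AdjoinRoot.of (curvePoly q F) X

/-- The class of `Y` in the coordinate ring. -/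
def y : CoordRing q F := AdjoinRoot.root (curvePoly q F)

/-- The points `(α, β)` of the Hermitian curve with coordinates in `F`. -/
abbrev Point : Type _ := {P : F × F // P.1 ^ (q + 1) = P.2 ^ q + P.2}

variable {q F}

/-- Evaluation `f ↦ f(α, β)` of elements of the coordinate ring at a point. -/
def evalAt (P : Point q F) : CoordRing q F →+* F :=
  AdjoinRoot.lift (evalRingHom P.1.1) P.1.2 (by
    simp only [curvePoly, eval₂_sub, eval₂_add, eval₂_pow, eval₂_X, eval₂_C, coe_evalRingHom,
      eval_pow, eval_X, P.2, sub_self])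

/-- The ideal `I ^ e` of all `f` vanishing at every point where `e` is nonzero. -/
def locatorIdeal (e : Point q F → F) : Ideal (CoordRing q F) where
  carrier := {f | ∀ P, e P ≠ 0 → evalAt P f = 0}
  add_mem' hf hg P hP := by rw [map_add, hf P hP, hg P hP, add_zero]
  zero_mem' P _ := map_zero _
  smul_mem' c f hf P hP := by rw [smul_eq_mul, map_mul, hf P hP, mul_zero]

section Finite

variable [Fintype F]

open Classical in
/-- The syndrome `S = ∑ e_P (x ^ (q+1) - α ^ (q+1)) / ((x - α) (y - β))` of `e`, the sum being
over all points `P = (α, β)` of the curve. -/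
def syndrome [Fact (IsPrimePow q)] (e : Point q F → F) : FunField q F :=
  ∑ P : Point q F,
    algebraMap (CoordRing q F) (FunField q F) (algebraMap F (CoordRing q F) (e P)) *
      (algebraMap (CoordRing q F) (FunField q F)
          (x q F ^ (q + 1) - algebraMap F (CoordRing q F) (P.1.1 ^ (q + 1))) /
        algebraMap (CoordRing q F) (FunField q F)
          ((x q F - algebraMap F (CoordRing q F) P.1.1) *
            (y q F - algebraMap F (CoordRing q F) P.1.2)))

open Classical in
/-- The syndrome values `s_{a,b} = ∑ e_P α ^ a β ^ b`, with `s_{a,b} = 0` for `a < 0`. -/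
def syndromeValue (e : Point q F → F) (a : ℤ) (b : ℕ) : F :=
  if 0 ≤ a then ∑ P : Point q F, e P * P.1.1 ^ a.toNat * P.1.2 ^ b else 0

/-- The pair `f, φ` solves the key equation for the syndrome of `e`: `f S = φ`. -/
def SolvesKeyEquation [Fact (IsPrimePow q)] (e : Point q F → F) (f φ : CoordRing q F) : Prop :=
  algebraMap (CoordRing q F) (FunField q F) f * syndrome e =
    algebraMap (CoordRing q F) (FunField q F) φ

end Finite

/-- The index `j` with `0 ≤ j < q` and `i + j ≡ m` modulo `q`. -/
def partner (m : ℕ) (i : Fin q) : Fin q :=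
  ⟨(m + (q - (i : ℕ))) % q, Nat.mod_lt _ i.pos⟩

theorem add_partner_modEq (m : ℕ) (i : Fin q) : (i : ℕ) + (partner m i : ℕ) ≡ m [MOD q] := by
  have h : (i : ℕ) + (m + (q - (i : ℕ))) = m + q := by have := i.isLt; omega
  calc (i : ℕ) + (partner m i : ℕ) ≡ (i : ℕ) + (m + (q - (i : ℕ))) [MOD q] :=
        Nat.ModEq.add_left _ (Nat.mod_modEq _ _)
    _ ≡ m [MOD q] := by rw [h]; exact Nat.add_modEq_right

theorem eq_partner {m : ℕ} {i j : Fin q} (h : (i : ℕ) + (j : ℕ) ≡ m [MOD q]) :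
    j = partner m i := by
  have h2 := Nat.ModEq.add_left_cancel' (i : ℕ) (h.trans (add_partner_modEq m i).symm)
  exact Fin.ext (Nat.ModEq.eq_of_lt_of_lt h2 j.isLt (partner m i).isLt)

variable [Fact (IsPrimePow q)]

/-- The unique polynomial `f_0(X) + f_1(X) Y + ⋯ + f_{q-1}(X) Y ^ (q-1)` representing `f`. -/
def stdRepr (f : CoordRing q F) : F[X][X] :=
  AdjoinRoot.modByMonicHom (curvePoly_monic q F) f

/-- The coefficient `f_{a,b}` of `x ^ a y ^ b` in `f`, with respect to the basis
`x ^ a y ^ b`, `0 ≤ a`, `0 ≤ b < q`. -/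
def stdCoeff (f : CoordRing q F) (a b : ℕ) : F := ((stdRepr f).coeff b).coeff a

/-- The order function `ρ`: the maximum of `a q + b (q+1)` over all `(a, b)` with `f_{a,b} ≠ 0`,
and `⊥` for `f = 0`. -/
def rho (f : CoordRing q F) : WithBot ℕ :=
  (stdRepr f).support.sup fun b =>
    ((stdRepr f).coeff b).support.sup fun a => ((a * q + b * (q + 1) : ℕ) : WithBot ℕ)

/-- The order as an integer; only meaningful for `f ≠ 0`. -/
def rhoInt (f : CoordRing q F) : ℤ := (((rho f).unbotD 0 : ℕ) : ℤ)

variable (q F) in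
/-- The set `Λ` of orders of nonzero elements of the coordinate ring. -/
def orders : Set ℕ := {n | ∃ f : CoordRing q F, rho f = (n : WithBot ℕ)}

/-- The set `ρ(I)` of orders of nonzero elements of an ideal. -/
def ordersOf (I : Ideal (CoordRing q F)) : Set ℕ := {n | ∃ f ∈ I, rho f = (n : WithBot ℕ)}

/-- The footprint `Δ ^ e = Λ \ ρ(I ^ e)`. -/
def footprint (e : Point q F → F) : Set ℕ := orders q F \ ordersOf (locatorIdeal e)

/-- The orders of nonzero elements of `I ^ e` that are congruent to `i` modulo `q`. -/
def residueOrders (e : Point q F → F) (i : Fin q) : Set ℕ :=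
  {n | n ∈ ordersOf (locatorIdeal e) ∧ n ≡ i [MOD q]}

/-- `σ_i`, the least order of a nonzero element of `I ^ e` congruent to `i` modulo `q`. -/
def sigma (e : Point q F → F) (i : Fin q) : ℕ := sInf (residueOrders e i)

/-- `σ_max`, the maximum of the `σ_i`. -/
def sigmaMax (e : Point q F → F) : ℕ := Finset.univ.sup (sigma e)

/-- `δ_max`, the maximum of the footprint (`0` for the empty footprint of `e = 0`). -/
def deltaMax (e : Point q F → F) : ℕ := sSup (footprint e)

/-- `M = σ_max + max (δ_max, q ^ 2 - q - 1)`. -/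
def lastIteration (e : Point q F → F) : ℕ := sigmaMax e + max (deltaMax e) (q ^ 2 - q - 1)

/-- The data `f_i, φ_i, g_i, ψ_i` (`0 ≤ i < q`) held by the decoding algorithm. -/
@[ext]
structure State (q : ℕ) (F : Type*) [Field F] where
  /-- the polynomials `f_i` -/
  f : Fin q → CoordRing q F
  /-- the polynomials `φ_i` -/
  φ : Fin q → CoordRing q F
  /-- the polynomials `g_i` -/
  g : Fin q → CoordRing q F
  /-- the polynomials `ψ_i` -/
  ψ : Fin q → CoordRing q F

variable (q F) in
/-- The elements `z*_b` of the `*`-basis: `y ^ (q-1) + 1` for `b = 0`, and `y ^ (q-1-b)`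
otherwise. -/
def starBasis (b : Fin q) : CoordRing q F :=
  if (b : ℕ) = 0 then y q F ^ (q - 1) + 1 else y q F ^ (q - 1 - (b : ℕ))

variable (q F) in
/-- The initial data `f_i = y ^ i`, `φ_i = 0`, `g_i = 0`, `ψ_i = -z*_i`. -/
def initState : State q F where
  f i := y q F ^ (i : ℕ)
  φ _ := 0
  g _ := 0
  ψ i := -starBasis q F i

/-- The integer `r_i = (m - d_i - j (q+1)) / q` with `d_i = ρ(f_i)`; the division is exact when
`d_i ≡ i` and `i + j ≡ m` modulo `q`. -/
def shift (m : ℕ) (st : State q F) (i j : Fin q) : ℤ :=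
  ((m : ℤ) - rhoInt (st.f i) - ((j : ℕ) : ℤ) * ((q : ℤ) + 1)) / (q : ℤ)

/-- The integer `p = (d_i + d_j - m) / q - 1`; the division is exact when `d_i ≡ i`, `d_j ≡ j` and
`i + j ≡ m` modulo `q`. -/
def gap (m : ℕ) (st : State q F) (i j : Fin q) : ℤ :=
  (rhoInt (st.f i) + rhoInt (st.f j) - (m : ℤ)) / (q : ℤ) - 1

/-- The discrepancy `μ_i = ∑_{c < q} ∑_a (y ^ j f_i)_{a,c} s_{a + r_i, c}`. -/
def discrepancy [Fintype F] (e : Point q F → F) (m : ℕ) (st : State q F) (i j : Fin q) : F :=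
  ∑ c ∈ Finset.range q,
    ∑ a ∈ ((stdRepr (y q F ^ (j : ℕ) * st.f i)).coeff c).support,
      stdCoeff (y q F ^ (j : ℕ) * st.f i) a c *
        syndromeValue e ((a : ℤ) + shift m st i j) c

open Classical in
/-- The update matrix `U_i`. In its first case `x ^ p` is only relevant for `p ≥ 0`, since
otherwise its coefficient `μ_i` is zero. -/
def updateMatrix [Fintype F] (e : Point q F → F) (m : ℕ) (st : State q F) (i j : Fin q) :
    Matrix (Fin 2) (Fin 2) (CoordRing q F) :=
  if discrepancy e m st i j = 0 ∨ 0 ≤ gap m st i j then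
    !![1, -(algebraMap F (CoordRing q F) (discrepancy e m st i j) *
        x q F ^ (gap m st i j).toNat);
      0, 1]
  else
    !![x q F ^ (-gap m st i j).toNat, -algebraMap F (CoordRing q F) (discrepancy e m st i j);
      algebraMap F (CoordRing q F) (discrepancy e m st i j)⁻¹, 0]

/-- The product of `U_i` with the matrix with rows `f_i, φ_i` and `g_j, ψ_j`. -/
def updateBlock [Fintype F] (e : Point q F → F) (m : ℕ) (st : State q F) (i j : Fin q) :
    Matrix (Fin 2) (Fin 2) (CoordRing q F) :=
  updateMatrix e m st i j * !![st.f i, st.φ i; st.g j, st.ψ j]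

/-- Iteration `m`. For every pair `i, j` with `i + j ≡ m` modulo `q`, that is, `j = partner m i`,
the rows of the updated block are the new `f_i, φ_i` and the new `g_j, ψ_j`. -/
def step [Fintype F] (e : Point q F → F) (m : ℕ) (st : State q F) : State q F where
  f i := updateBlock e m st i (partner m i) 0 0
  φ i := updateBlock e m st i (partner m i) 0 1
  g j := updateBlock e m st (partner m j) j 1 0
  ψ j := updateBlock e m st (partner m j) j 1 1

/-- The data after the iterations `0, …, m - 1`: its components are `f_i^(m)`, `φ_i^(m)`,
`g_i^(m)` and `ψ_i^(m)`. -/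
def run [Fintype F] (e : Point q F → F) : ℕ → State q F
  | 0 => initState q F
  | m + 1 => step e m (run e m)

end

end Hermitian

/-!
A pair `f, φ` is judged by its residuals, the coefficients of `f S - φ` in the Laurent monomials
`x ^ (-a-1) z*_b`, listed by the order `n = a q + b (q + 1)` of the dual monomials `x ^ a y ^ b`.
Iteration `m` removes the residual of `f_i, φ_i` at `n = m - ρ(f_i)`, all earlier ones being zero
already, with the help of a pair `g_j, ψ_j` whose residuals start at an order of the same residue
class. If this raises the order of `f_i`, then the old `f_i, φ_i` becomes the new helper of its
partner `j`. The two partners change together: the first nonzero residual of `u` is the value of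
`h ↦ ∑ e_P h(P) u(P)` at a monic `h` of the dual order, and `(h u)(P)` is symmetric in `h` and `u`.

An element of `I ^ e` pairs to zero with everything, whereas a helper `g_i, ψ_i` pairs to a nonzero
value with every function of its residual order `ρ(f_i) - q`. Hence `ρ(f_i) - q < σ_i`, that is,
`ρ(f_i) ≤ σ_i`. After `m > σ_max + δ_max` the residuals of `f_i` vanish up to order `δ_max`, so
`f_i` pairs to zero with the functions of order at most `δ_max`. These span `R / I ^ e`, and the
pairing detects membership in `I ^ e`. For `f ∈ I ^ e` the product `f S` lies in `R`, so only
residuals of order at most `q ^ 2 - q - 1` can be nonzero, and once these vanish `f S = φ`.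
-/

namespace Hermitian

open Polynomial

noncomputable section

instance {q : ℕ} [hq : Fact (IsPrimePow q)] : NeZero q := ⟨hq.out.ne_zero⟩

section Exponents

variable (q : ℕ)

/-- The order `r q + j (q + 1)` of the Laurent monomial `x ^ r y ^ j`. As `j` runs over `Fin q`
and `r` over `ℤ` it takes every integer value exactly once; the inverse is `n ↦ (xExp q n,
yExp q n)`. -/
def monomialOrder (r : ℤ) (j : Fin q) : ℤ := r * q + (j : ℕ) * (q + 1)

variable [NeZero q]

/-- The exponent of `y` in the Laurent monomial of order `n`. -/
def yExp (n : ℤ) : Fin q :=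
  ⟨(n % q).toNat, (Int.toNat_lt' (NeZero.pos q)).2
    (n.emod_lt_of_pos (by exact_mod_cast NeZero.pos q))⟩

/-- The exponent of `x` in the Laurent monomial of order `n`. -/
def xExp (n : ℤ) : ℤ := n / q - n % q

variable {q}

lemma coe_yExp (n : ℤ) : ((yExp q n : ℕ) : ℤ) = n % q :=
  Int.toNat_of_nonneg (n.emod_nonneg (by exact_mod_cast NeZero.ne q))

lemma monomialOrder_xExp_yExp (n : ℤ) : monomialOrder q (xExp q n) (yExp q n) = n := by
  rw [monomialOrder, coe_yExp, xExp]
  linear_combination n.mul_ediv_add_emod q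

lemma yExp_monomialOrder (r : ℤ) (j : Fin q) : yExp q (monomialOrder q r j) = j := by
  have hj : ((j : ℕ) : ℤ) < q := by exact_mod_cast j.isLt
  have hn : monomialOrder q r j = j + (r + j) * q := by rw [monomialOrder]; ring
  rw [Fin.ext_iff, ← Int.natCast_inj, coe_yExp, hn, Int.add_mul_emod_self_right,
    Int.emod_eq_of_lt (by positivity) hj]

lemma xExp_monomialOrder (r : ℤ) (j : Fin q) : xExp q (monomialOrder q r j) = r := by
  have h := monomialOrder_xExp_yExp (q := q) (monomialOrder q r j)
  rw [yExp_monomialOrder, monomialOrder, monomialOrder, add_left_inj] at h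
  exact mul_right_cancel₀ (by exact_mod_cast NeZero.ne q) h

lemma eq_monomialOrder_iff {n r : ℤ} {j : Fin q} :
    n = monomialOrder q r j ↔ xExp q n = r ∧ yExp q n = j := by
  constructor
  · rintro rfl
    exact ⟨xExp_monomialOrder r j, yExp_monomialOrder r j⟩
  · rintro ⟨rfl, rfl⟩
    exact (monomialOrder_xExp_yExp n).symm

lemma xExp_add_mul (n p : ℤ) : xExp q (n + p * q) = xExp q n + p := by
  have hq : (q : ℤ) ≠ 0 := by exact_mod_cast NeZero.ne q
  rw [xExp, xExp, Int.add_mul_ediv_right _ _ hq, Int.add_mul_emod_self_right]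
  ring

lemma yExp_add_mul (n p : ℤ) : yExp q (n + p * q) = yExp q n := by
  simp only [yExp, Int.add_mul_emod_self_right]

lemma yExp_eq_iff {n : ℤ} {j : Fin q} : yExp q n = j ↔ n ≡ (j : ℕ) [ZMOD q] := by
  have hj : ((j : ℕ) : ℤ) < q := by exact_mod_cast j.isLt
  rw [Fin.ext_iff, ← Int.natCast_inj, coe_yExp, Int.ModEq,
    Int.emod_eq_of_lt (a := (j : ℕ)) (by positivity) hj]

end Exponents

section IntCoeff

variable {R : Type*} [CommSemiring R]

/-- The coefficient of `X ^ k` for an integer `k`, which is `0` for `k < 0`. -/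
def intCoeff (k : ℤ) : R[X] →ₗ[R] R := if 0 ≤ k then lcoeff R k.toNat else 0

lemma intCoeff_natCast (k : ℕ) (p : R[X]) : intCoeff (k : ℤ) p = p.coeff k := by
  simp [intCoeff]

lemma intCoeff_of_neg {k : ℤ} (hk : k < 0) (p : R[X]) : intCoeff k p = 0 := by
  simp [intCoeff, hk.not_ge]

lemma intCoeff_X_pow_mul (k : ℤ) (n : ℕ) (p : R[X]) :
    intCoeff k (X ^ n * p) = intCoeff (k - n) p := by
  rcases lt_or_ge k 0 with hk | hk
  · rw [intCoeff_of_neg hk, intCoeff_of_neg (by omega)]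
  lift k to ℕ using hk
  rw [intCoeff_natCast, coeff_X_pow_mul']
  split_ifs with h
  · rw [← Nat.cast_sub h, intCoeff_natCast]
  · rw [intCoeff_of_neg (by omega)]

lemma intCoeff_X_pow (k : ℤ) (n : ℕ) : intCoeff k (X ^ n : R[X]) = if k = n then 1 else 0 := by
  rcases lt_or_ge k 0 with hk | hk
  · rw [intCoeff_of_neg hk, if_neg (by omega)]
  lift k to ℕ using hk
  simp only [intCoeff_natCast, coeff_X_pow, Nat.cast_inj]

end IntCoeff

variable {q : ℕ} {F : Type*} [Field F]

lemma X_smul_eq (f : CoordRing q F) : (X : F[X]) • f = x q F * f := Algebra.smul_def _ _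

lemma X_pow_smul_eq (p : ℕ) (f : CoordRing q F) : (X ^ p : F[X]) • f = x q F ^ p * f := by
  rw [Algebra.smul_def, map_pow]; rfl

lemma C_smul_eq (c : F) (f : CoordRing q F) : (C c : F[X]) • f = c • f := by
  rw [← algebraMap_eq, algebraMap_smul]

lemma y_pow_add_y : y q F ^ q + y q F = x q F ^ (q + 1) := by
  have h : AdjoinRoot.mk (curvePoly q F) (X ^ q + X - C (X ^ (q + 1))) = 0 := AdjoinRoot.mk_self
  rwa [map_sub, map_add, map_pow, AdjoinRoot.mk_X, AdjoinRoot.mk_C, map_pow, sub_eq_zero] at h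

lemma y_pow_add (k : ℕ) :
    y q F ^ (q + k) = (X ^ (q + 1) : F[X]) • y q F ^ k - y q F ^ (k + 1) := by
  rw [X_pow_smul_eq, ← y_pow_add_y]
  ring

variable [Fact (IsPrimePow q)]

section Order

lemma natDegree_curvePoly : (curvePoly q F).natDegree = q := by
  have hq := one_lt_of_primePow q
  rw [curvePoly, add_sub_assoc, natDegree_add_eq_left_of_natDegree_lt] <;>
    simp [-map_pow, hq]

lemma stdRepr_y_pow {k : ℕ} (hk : k < q) : stdRepr (y q F ^ k) = X ^ k := by
  rw [y, ← AdjoinRoot.mk_X, ← map_pow, stdRepr, AdjoinRoot.modByMonicHom_mk,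
    modByMonic_eq_self_iff (curvePoly_monic q F), degree_X_pow,
    degree_eq_natDegree (curvePoly_monic q F).ne_zero, natDegree_curvePoly]
  exact_mod_cast hk

lemma natDegree_stdRepr_lt (f : CoordRing q F) : (stdRepr f).natDegree < q := by
  obtain ⟨p, rfl⟩ := AdjoinRoot.mk_surjective f
  have hdeg := natDegree_curvePoly (q := q) (F := F)
  refine (natDegree_modByMonic_lt p (curvePoly_monic q F) fun h => ?_).trans_eq hdeg
  rw [h, natDegree_one] at hdeg
  exact NeZero.ne q hdeg.symm

/-- The coefficient, with respect to the basis `x ^ a y ^ b` (`0 ≤ a`, `0 ≤ b < q`), of the basis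
element of order `n`; it is `0` if there is no such element. -/
def coeffAt (n : ℤ) : CoordRing q F →ₗ[F] F :=
  intCoeff (xExp q n) ∘ₗ (lcoeff F[X] (yExp q n) ∘ₗ
    AdjoinRoot.modByMonicHom (curvePoly_monic q F)).restrictScalars F

lemma coeffAt_apply (n : ℤ) (f : CoordRing q F) :
    coeffAt n f = intCoeff (xExp q n) ((stdRepr f).coeff (yExp q n)) := rfl

lemma coeffAt_monomialOrder (r : ℤ) (j : Fin q) (f : CoordRing q F) :
    coeffAt (monomialOrder q r j) f = intCoeff r ((stdRepr f).coeff j) := by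
  rw [coeffAt_apply, xExp_monomialOrder, yExp_monomialOrder]

lemma coeffAt_X_pow_smul (n : ℤ) (p : ℕ) (f : CoordRing q F) :
    coeffAt n ((X ^ p : F[X]) • f) = coeffAt (n - p * q) f := by
  have h : n - p * q = n + (-p : ℤ) * q := by ring
  rw [h, coeffAt_apply, coeffAt_apply, xExp_add_mul, yExp_add_mul, stdRepr, map_smul, coeff_smul,
    smul_eq_mul, intCoeff_X_pow_mul]
  rfl

lemma coeffAt_X_pow_smul_y_pow (n : ℤ) (a : ℕ) (b : Fin q) :
    coeffAt n ((X ^ a : F[X]) • y q F ^ (b : ℕ)) = if n = monomialOrder q a b then 1 else 0 := by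
  have hr : stdRepr ((X ^ a : F[X]) • y q F ^ (b : ℕ)) = (X ^ a : F[X]) • X ^ (b : ℕ) := by
    rw [← stdRepr_y_pow (F := F) b.isLt]
    exact map_smul (AdjoinRoot.modByMonicHom (curvePoly_monic q F)) _ _
  rw [coeffAt_apply, hr, coeff_smul, coeff_X_pow, smul_eq_mul, mul_ite, mul_one, mul_zero,
    apply_ite (intCoeff (R := F) (xExp q n)), map_zero, intCoeff_X_pow, ← ite_and]
  simp only [eq_monomialOrder_iff, Fin.val_inj, and_comm]

lemma coeffAt_eq_zero_of_neg {n : ℤ} (hn : n < 0) (f : CoordRing q F) : coeffAt n f = 0 := by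
  refine intCoeff_of_neg ?_ _
  have h1 := monomialOrder_xExp_yExp (q := q) n
  rw [monomialOrder] at h1
  by_contra! h
  have : 0 ≤ xExp q n * (q : ℤ) + (yExp q n : ℕ) * ((q : ℤ) + 1) := by positivity
  omega

lemma eq_zero_of_coeffAt_eq_zero {f : CoordRing q F} (hf : ∀ n, coeffAt n f = 0) : f = 0 := by
  have h : stdRepr f = 0 := by
    ext b a
    rcases lt_or_ge b q with hb | hb
    · have := hf (monomialOrder q a ⟨b, hb⟩)
      rwa [coeffAt_monomialOrder, intCoeff_natCast] at this
    · rw [coeff_eq_zero_of_natDegree_lt ((natDegree_stdRepr_lt f).trans_le hb), coeff_zero,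
        coeff_zero, coeff_zero]
  rw [← AdjoinRoot.mk_leftInverse (curvePoly_monic q F) f]
  exact (congrArg _ h).trans (map_zero _)

variable (q F) in
/-- The elements all of whose monomials `x ^ a y ^ b` have order at most `N`. -/
def orderLE (N : ℤ) : Submodule F (CoordRing q F) := ⨅ n : Set.Ioi N, LinearMap.ker (coeffAt n.1)

lemma mem_orderLE {N : ℤ} {f : CoordRing q F} : f ∈ orderLE q F N ↔ ∀ n > N, coeffAt n f = 0 := by
  simp [orderLE]

lemma orderLE_mono {M N : ℤ} (h : M ≤ N) : orderLE q F M ≤ orderLE q F N :=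
  fun _ hf => mem_orderLE.2 fun n hn => mem_orderLE.1 hf n (h.trans_lt hn)

lemma eq_zero_of_mem_orderLE_of_neg {N : ℤ} (hN : N < 0) {f : CoordRing q F}
    (hf : f ∈ orderLE q F N) : f = 0 :=
  eq_zero_of_coeffAt_eq_zero fun n => (lt_or_ge n 0).elim (coeffAt_eq_zero_of_neg · f)
    fun hn => mem_orderLE.1 hf n (hN.trans_le hn)

lemma mem_orderLE_sub_one {N : ℤ} {f : CoordRing q F} (hf : f ∈ orderLE q F N)
    (h0 : coeffAt N f = 0) : f ∈ orderLE q F (N - 1) :=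
  mem_orderLE.2 fun n hn => (eq_or_ne n N).elim (fun h => h ▸ h0)
    fun h => mem_orderLE.1 hf n (by omega)

lemma X_pow_smul_mem_orderLE {N : ℤ} {f : CoordRing q F} (hf : f ∈ orderLE q F N) (p : ℕ) :
    (X ^ p : F[X]) • f ∈ orderLE q F (N + p * q) :=
  mem_orderLE.2 fun n hn => by
    rw [coeffAt_X_pow_smul]
    exact mem_orderLE.1 hf _ (by omega)

lemma X_pow_smul_y_pow_mem_orderLE (a : ℕ) (b : Fin q) :
    (X ^ a : F[X]) • y q F ^ (b : ℕ) ∈ orderLE q F (monomialOrder q a b) :=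
  mem_orderLE.2 fun n hn => by rw [coeffAt_X_pow_smul_y_pow, if_neg hn.ne']

lemma sub_smul_mem_orderLE_sub_one {N : ℤ} {f u : CoordRing q F} (hf : f ∈ orderLE q F N)
    (h0 : coeffAt N f ≠ 0) (hu : u ∈ orderLE q F N) :
    u - (coeffAt N u / coeffAt N f) • f ∈ orderLE q F (N - 1) := by
  refine mem_orderLE_sub_one (sub_mem hu (Submodule.smul_mem _ _ hf)) ?_
  rw [map_sub, map_smul, smul_eq_mul, div_mul_cancel₀ _ h0, sub_self]

lemma rho_lt_iff {f : CoordRing q F} {n : ℕ} : rho f < n ↔ f ∈ orderLE q F (n - 1) := by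
  have hbot : ⊥ < (n : WithBot ℕ) := WithBot.bot_lt_coe n
  simp only [rho, Finset.sup_lt_iff hbot, mem_orderLE, mem_support_iff, Nat.cast_lt]
  constructor
  · intro h N hN
    by_contra h0
    have ha : 0 ≤ xExp q N := not_lt.1 fun ha => h0 (intCoeff_of_neg ha _)
    obtain ⟨a, ha⟩ := Int.eq_ofNat_of_zero_le ha
    rw [coeffAt_apply, ha, intCoeff_natCast] at h0
    have hlt := h (yExp q N) (fun h1 => h0 (by rw [h1, coeff_zero])) a h0
    rw [← monomialOrder_xExp_yExp (q := q) N, ha, monomialOrder] at hN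
    exact (Int.sub_one_lt_iff.1 hN).not_gt (by exact_mod_cast hlt)
  · intro h b hb a ha
    have hbq : b < q := (le_natDegree_of_ne_zero hb).trans_lt (natDegree_stdRepr_lt f)
    by_contra! hle
    refine ha ?_
    rw [← intCoeff_natCast a, ← coeffAt_monomialOrder a ⟨b, hbq⟩]
    exact h _ (Int.sub_one_lt_iff.2 (by rw [monomialOrder]; exact_mod_cast hle))

lemma rho_eq_iff {f : CoordRing q F} {n : ℕ} :
    rho f = n ↔ f ∈ orderLE q F n ∧ coeffAt n f ≠ 0 := by
  have hle : rho f ≤ n ↔ f ∈ orderLE q F n := by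
    rw [← add_sub_cancel_right (n : ℤ) 1, ← Nat.cast_add_one, ← rho_lt_iff]
    cases rho f with
    | bot => simp
    | coe k => exact WithBot.coe_le_coe.trans (Nat.lt_succ_iff.symm.trans WithBot.coe_lt_coe.symm)
  rw [eq_iff_le_not_lt, hle, rho_lt_iff]
  refine and_congr_right fun hf => not_congr ⟨fun h => mem_orderLE.1 h n (by simp),
    mem_orderLE_sub_one hf⟩

lemma rhoInt_eq {f : CoordRing q F} {d : ℤ} (hf : f ∈ orderLE q F d) (h0 : coeffAt d f ≠ 0) :
    rhoInt f = d := by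
  have hd : 0 ≤ d := not_lt.1 fun h => h0 (coeffAt_eq_zero_of_neg h f)
  lift d to ℕ using hd
  rw [rhoInt, rho_eq_iff.2 ⟨hf, h0⟩, Nat.cast_withBot, WithBot.unbotD_coe]

end Order

section LaurentCoeff

variable {R : Type*} [CommRing R]

/-- The linear functional with `X ^ a ↦ α ^ (a + r)` for `a + r ≥ 0` and `X ^ a ↦ 0` otherwise.
Its value at `p` is the coefficient of `X ^ (-r-1)` in the expansion of `p / (X - α)` in powers of
`X⁻¹`. -/
def laurentCoeff (α : R) (r : ℤ) : R[X] →ₗ[R] R :=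
  lsum fun a => (if 0 ≤ a + r then α ^ (a + r).toNat else 0) • LinearMap.id

lemma laurentCoeff_apply (α : R) (r : ℤ) (p : R[X]) :
    laurentCoeff α r p =
      ∑ a ∈ p.support, p.coeff a * if 0 ≤ a + r then α ^ (a + r).toNat else 0 := by
  simp only [laurentCoeff, lsum_apply, sum_def, LinearMap.smul_apply, LinearMap.id_apply,
    smul_eq_mul, mul_comm]

lemma laurentCoeff_monomial (α : R) (r : ℤ) (a : ℕ) (c : R) :
    laurentCoeff α r (monomial a c) = c * if 0 ≤ a + r then α ^ (a + r).toNat else 0 := by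
  rw [laurentCoeff, lsum_apply, sum_monomial_index _ _ (by simp), LinearMap.smul_apply,
    LinearMap.id_apply, smul_eq_mul, mul_comm]

lemma laurentCoeff_X_pow_mul (α : R) (r : ℤ) (n : ℕ) (p : R[X]) :
    laurentCoeff α r (X ^ n * p) = laurentCoeff α (r + n) p := by
  induction p using Polynomial.induction_on' with
  | add p₁ p₂ h₁ h₂ => rw [mul_add, map_add, map_add, h₁, h₂]
  | monomial a c =>
    rw [X_pow_mul_monomial, laurentCoeff_monomial, laurentCoeff_monomial, Nat.cast_add, add_assoc,
      add_comm (n : ℤ)]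

lemma laurentCoeff_natCast (α : R) (r : ℕ) (p : R[X]) :
    laurentCoeff α r p = α ^ r * p.eval α := by
  induction p using Polynomial.induction_on' with
  | add p₁ p₂ h₁ h₂ => rw [map_add, h₁, h₂, eval_add, mul_add]
  | monomial a c =>
    rw [laurentCoeff_monomial, ← Nat.cast_add, if_pos (Nat.cast_nonneg _), Int.toNat_natCast,
      eval_monomial]
    ring

lemma laurentCoeff_X_sub_C_mul (α : R) (r : ℤ) (p : R[X]) :
    laurentCoeff α r ((X - C α) * p) = intCoeff (-r - 1) p := by
  induction p using Polynomial.induction_on' with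
  | add p₁ p₂ h₁ h₂ => rw [mul_add, map_add, map_add, h₁, h₂]
  | monomial a c =>
    rw [sub_mul, map_sub, X_mul_monomial, C_mul_monomial, laurentCoeff_monomial,
      laurentCoeff_monomial, ← mul_one c, ← smul_eq_mul (a := c) (b := 1), ← smul_monomial,
      map_smul, monomial_one_right_eq_X_pow, intCoeff_X_pow]
    rcases lt_trichotomy (a + r) (-1) with h | h | h
    · rw [if_neg (by omega), if_neg (by omega), if_neg (by omega)]; simp
    · rw [if_pos (by omega), if_neg (by omega), if_pos (by omega)]
      simp [show (a : ℤ) + 1 + r = 0 by omega]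
    · rw [if_pos (by omega), if_pos (by omega), if_neg (by omega), Nat.cast_add_one,
        show ((a : ℤ) + 1 + r).toNat = (a + r).toNat + 1 by omega, pow_succ]
      simp only [smul_eq_mul]
      ring

lemma laurentCoeff_eq_zero {r : ℤ} {p : R[X]} (h : p.natDegree + r < 0) (α : R) :
    laurentCoeff α r p = 0 := by
  rw [laurentCoeff_apply]
  refine Finset.sum_eq_zero fun a ha => ?_
  have := le_natDegree_of_mem_supp a ha
  rw [if_neg (by omega), mul_zero]

end LaurentCoeff

section EvalY

variable (q) in
/-- Substitution of `β` for `y` in the standard representation; not a ring homomorphism. -/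
def evalY (β : F) : CoordRing q F →ₗ[F[X]] F[X] :=
  (aeval (C β : F[X])).toLinearMap ∘ₗ AdjoinRoot.modByMonicHom (curvePoly_monic q F)

lemma evalY_apply (β : F) (f : CoordRing q F) :
    evalY q β f = ∑ c ∈ Finset.range q, C (β ^ c) * (stdRepr f).coeff c := by
  have h : evalY q β f = (stdRepr f).eval (C β) := aeval_def _ _
  rw [h, eval_eq_sum_range' (natDegree_stdRepr_lt f)]
  simp only [mul_comm, map_pow]

lemma eval_evalY (P : Point q F) (f : CoordRing q F) :
    (evalY q P.1.2 f).eval P.1.1 = evalAt P f := by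
  have hmk : AdjoinRoot.mk _ (stdRepr f) = f := AdjoinRoot.mk_leftInverse (curvePoly_monic q F) f
  have hev : evalAt P f = (stdRepr f).eval₂ (evalRingHom P.1.1) P.1.2 := by
    nth_rw 1 [← hmk]
    exact AdjoinRoot.lift_mk _ _
  rw [hev, eval₂_eq_sum_range' _ (natDegree_stdRepr_lt f), evalY_apply, eval_finsetSum]
  simp only [eval_mul, eval_C, coe_evalRingHom, mul_comm]

lemma evalY_y_pow (β : F) {k : ℕ} (hk : k < q) : evalY q β (y q F ^ k) = C (β ^ k) := by
  have h : evalY q β (y q F ^ k) = aeval (C β) (stdRepr (y q F ^ k)) := rfl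
  rw [h, stdRepr_y_pow hk, map_pow, aeval_X, map_pow]

lemma natDegree_evalY_y_pow_mul_le (β : F) (k : ℕ) :
    (evalY q β (y q F ^ k)).natDegree * q ≤ k * (q + 1) := by
  induction k using Nat.strong_induction_on with
  | _ k ih =>
    rcases lt_or_ge k q with hk | hk
    · rw [evalY_y_pow β hk, natDegree_C, zero_mul]
      exact Nat.zero_le _
    obtain ⟨l, rfl⟩ := Nat.exists_eq_add_of_le hk
    have hq := one_lt_of_primePow q
    have h₁ := ih l (by omega)
    have h₂ := ih (l + 1) (by omega)
    have hle := natDegree_sub_le (X ^ (q + 1) * evalY q β (y q F ^ l)) (evalY q β (y q F ^ (l + 1)))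
    have hmul := natDegree_mul_le (p := (X ^ (q + 1) : F[X])) (q := evalY q β (y q F ^ l))
    rw [natDegree_X_pow] at hmul
    rw [y_pow_add, map_sub, map_smul, smul_eq_mul]
    rcases le_max_iff.1 hle with h | h
    · nlinarith
    · nlinarith

lemma laurentCoeff_evalY (α β : F) (r : ℤ) (f : CoordRing q F) :
    laurentCoeff α r (evalY q β f) =
      ∑ c ∈ Finset.range q, ∑ a ∈ ((stdRepr f).coeff c).support,
        stdCoeff f a c * ((if 0 ≤ a + r then α ^ (a + r).toNat else 0) * β ^ c) := by
  simp only [evalY_apply, map_sum, ← smul_eq_C_mul, map_smul, laurentCoeff_apply, smul_eq_mul,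
    Finset.mul_sum, stdCoeff]
  refine Finset.sum_congr rfl fun c _ => Finset.sum_congr rfl fun a _ => ?_
  ring

end EvalY

section Syndrome

variable [Fintype F] (e : Point q F → F)

open Classical in
/-- The pairing `f ↦ ∑ e_P f(P)` of the error vector with functions on the curve. -/
def errorSum : CoordRing q F →ₗ[F] F :=
  ∑ P : Point q F, e P • (leval P.1.1 ∘ₗ (evalY q P.1.2).restrictScalars F)

open Classical in
/-- The coefficient of `x ^ (-a-1) z*_b` in `f S`, where `x ^ a y ^ b` is the Laurent monomial of
order `n` and the syndrome `S` is expanded in powers of `x⁻¹`. For `a ≥ 0` it is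
`∑ e_P α ^ a β ^ b f(P)`. -/
def syndromeCoeff (n : ℤ) : CoordRing q F →ₗ[F] F :=
  ∑ P : Point q F, e P • (laurentCoeff P.1.1 (xExp q n) ∘ₗ (evalY q P.1.2).restrictScalars F ∘ₗ
    LinearMap.mulLeft F (y q F ^ (yExp q n : ℕ)))

open Classical in
lemma errorSum_apply (f : CoordRing q F) : errorSum e f = ∑ P : Point q F, e P * evalAt P f := by
  simp [errorSum, leval_apply, eval_evalY]

open Classical in
lemma syndromeCoeff_apply (n : ℤ) (f : CoordRing q F) :
    syndromeCoeff e n f = ∑ P : Point q F, e P *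
      laurentCoeff P.1.1 (xExp q n) (evalY q P.1.2 (y q F ^ (yExp q n : ℕ) * f)) := by
  simp [syndromeCoeff]

lemma syndromeCoeff_X_pow_smul (n : ℤ) (p : ℕ) (f : CoordRing q F) :
    syndromeCoeff e n ((X ^ p : F[X]) • f) = syndromeCoeff e (n + p * q) f := by
  simp only [syndromeCoeff_apply, mul_smul_comm, map_smul, smul_eq_mul, laurentCoeff_X_pow_mul,
    xExp_add_mul, yExp_add_mul]

lemma syndromeCoeff_monomialOrder (a : ℕ) (b : Fin q) (f : CoordRing q F) :
    syndromeCoeff e (monomialOrder q a b) f =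
      errorSum e ((X ^ a : F[X]) • y q F ^ (b : ℕ) * f) := by
  simp only [syndromeCoeff_apply, xExp_monomialOrder, yExp_monomialOrder, laurentCoeff_natCast,
    eval_evalY, errorSum_apply, smul_mul_assoc]
  refine Finset.sum_congr rfl fun P _ => ?_
  rw [← eval_evalY P ((X ^ a : F[X]) • _), map_smul, smul_eq_mul, eval_mul, eval_pow, eval_X,
    eval_evalY]

lemma syndromeCoeff_y_pow_eq_zero (i : Fin q) {n : ℤ} (hn : n < -((i : ℕ) * (q + 1) : ℤ)) :
    syndromeCoeff e n (y q F ^ (i : ℕ)) = 0 := by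
  rw [syndromeCoeff_apply]
  refine Finset.sum_eq_zero fun P _ => ?_
  rw [← pow_add, laurentCoeff_eq_zero, mul_zero]
  have hq : (0 : ℤ) < q := by exact_mod_cast NeZero.pos q
  have hdeg : ((evalY q P.1.2 (y q F ^ ((yExp q n : ℕ) + (i : ℕ)))).natDegree * q : ℤ) ≤
      ((yExp q n : ℕ) + (i : ℕ)) * (q + 1) := by
    exact_mod_cast natDegree_evalY_y_pow_mul_le P.1.2 _
  have hsplit := monomialOrder_xExp_yExp (q := q) n
  rw [monomialOrder] at hsplit
  nlinarith [hq]

omit [Fact (IsPrimePow q)] in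
open Classical in
lemma syndromeValue_eq_sum (a : ℤ) (b : ℕ) : syndromeValue e a b =
    ∑ P : Point q F, e P * ((if 0 ≤ a then P.1.1 ^ a.toNat else 0) * P.1.2 ^ b) := by
  rw [syndromeValue]
  split_ifs <;> simp [mul_assoc]

open Classical in
lemma discrepancy_eq_syndromeCoeff (m : ℕ) (st : State q F) (i j : Fin q) :
    discrepancy e m st i j = syndromeCoeff e (monomialOrder q (shift m st i j) j) (st.f i) := by
  simp only [syndromeCoeff_apply, xExp_monomialOrder, yExp_monomialOrder, laurentCoeff_evalY,
    discrepancy, syndromeValue_eq_sum, Finset.mul_sum]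
  rw [Finset.sum_comm (s := Finset.univ)]
  refine Finset.sum_congr rfl fun c _ => ?_
  rw [Finset.sum_comm]
  exact Finset.sum_congr rfl fun a _ => Finset.sum_congr rfl fun P _ => mul_left_comm _ _ _

end Syndrome

section StarBasis

variable (q F) in
/-- The linear combination `∑ c_j z*_j` with coefficients in `F[X]`. -/
def starSum : (Fin q → F[X]) →ₗ[F[X]] CoordRing q F :=
  Fintype.linearCombination F[X] (starBasis q F)

lemma starSum_eq (c : ℕ → F[X]) :
    starSum q F (fun j => c j) = c 0 • 1 + ∑ j ∈ Finset.range q, c j • y q F ^ (q - 1 - j) := by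
  have hstar (j : Fin q) :
      starBasis q F j = (if j = 0 then 1 else 0) + y q F ^ (q - 1 - (j : ℕ)) := by
    simp only [starBasis, Fin.val_eq_zero_iff]
    split_ifs with h
    · rw [h, Fin.val_zero, Nat.sub_zero, add_comm]
    · rw [zero_add]
  simp only [starSum, Fintype.linearCombination_apply, hstar, smul_add, Finset.sum_add_distrib,
    smul_ite, smul_zero, Finset.sum_ite_eq', Finset.mem_univ, if_true, Fin.val_zero]
  rw [Fin.sum_univ_eq_sum_range (fun j => c j • y q F ^ (q - 1 - j))]

/-- `S(y f) - y S(f)` telescopes to `L((y ^ q + y) f) - (y ^ q + y) L(f)`, and `y ^ q + y` is the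
scalar `x ^ (q + 1)`. -/
lemma starSum_y_mul (L : CoordRing q F →ₗ[F[X]] F[X]) (f : CoordRing q F) :
    starSum q F (fun j => L (y q F ^ (j : ℕ) * (y q F * f))) =
      y q F * starSum q F (fun j => L (y q F ^ (j : ℕ) * f)) := by
  rw [starSum_eq fun j => L (y q F ^ j * (y q F * f)), starSum_eq fun j => L (y q F ^ j * f)]
  have htel := Finset.sum_range_sub (fun j => L (y q F ^ j * f) • y q F ^ (q - j)) q
  have hterm : ∀ j ∈ Finset.range q,
      L (y q F ^ (j + 1) * f) • y q F ^ (q - (j + 1)) - L (y q F ^ j * f) • y q F ^ (q - j) =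
      L (y q F ^ j * (y q F * f)) • y q F ^ (q - 1 - j) -
        y q F * (L (y q F ^ j * f) • y q F ^ (q - 1 - j)) := by
    intro j hj
    have hj := Finset.mem_range.1 hj
    rw [show q - j = q - 1 - j + 1 by omega, show q - (j + 1) = q - 1 - j by omega, pow_succ,
      pow_succ, mul_assoc, mul_smul_comm, mul_comm (y q F) (y q F ^ (q - 1 - j))]
  rw [Finset.sum_congr rfl hterm, Finset.sum_sub_distrib, ← Finset.mul_sum] at htel
  have hscalar : algebraMap F[X] (CoordRing q F) (L (y q F ^ q * f)) +
      algebraMap F[X] (CoordRing q F) (L (y q F * f)) =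
      x q F ^ (q + 1) * algebraMap F[X] (CoordRing q F) (L f) := by
    rw [← map_add, ← map_add, ← add_mul, y_pow_add_y, ← X_pow_smul_eq, map_smul, ← X_pow_smul_eq,
      smul_eq_mul, map_mul, Algebra.smul_def]
  simp only [Algebra.smul_def, Nat.sub_self, Nat.sub_zero, pow_zero, one_mul] at htel ⊢
  linear_combination htel + hscalar -
    algebraMap F[X] (CoordRing q F) (L f) * y_pow_add_y (q := q) (F := F)

lemma starSum_mul (L : CoordRing q F →ₗ[F[X]] F[X]) (f : CoordRing q F) :
    starSum q F (fun j => L (y q F ^ (j : ℕ) * f)) =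
      f * starSum q F (fun j => L (y q F ^ (j : ℕ))) := by
  obtain ⟨p, rfl⟩ := AdjoinRoot.mk_surjective f
  induction p using Polynomial.induction_on with
  | C a =>
    have hsmul (g : CoordRing q F) : g * AdjoinRoot.mk _ (C a) = a • g := by
      rw [Algebra.smul_def, mul_comm]; rfl
    simp only [mul_comm (AdjoinRoot.mk _ (C a)), hsmul, map_smul]
    exact map_smul (starSum q F) a _
  | add p₁ p₂ h₁ h₂ =>
    simp only [map_add, mul_add, add_mul, ← h₁, ← h₂]
    exact map_add (starSum q F) _ _
  | monomial n a h =>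
    have hy : AdjoinRoot.mk (curvePoly q F) (C a * X ^ (n + 1)) =
        y q F * AdjoinRoot.mk _ (C a * X ^ n) := by
      rw [pow_succ, ← mul_assoc, map_mul, mul_comm]; rfl
    simp only [hy, starSum_y_mul, h, mul_assoc]

lemma y_sub_mul_starSum_C_pow (P : Point q F) :
    (y q F - algebraMap F _ P.1.2) * starSum q F (fun j => C (P.1.2 ^ (j : ℕ))) =
      x q F ^ (q + 1) - algebraMap F _ (P.1.1 ^ (q + 1)) := by
  have hstar : starSum q F (fun j => C (P.1.2 ^ (j : ℕ))) =
      1 + ∑ j ∈ Finset.range q, algebraMap F _ P.1.2 ^ j * y q F ^ (q - 1 - j) := by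
    rw [starSum_eq fun j => C (P.1.2 ^ j)]
    simp only [C_smul_eq, pow_zero, one_smul, ← map_pow, ← Algebra.smul_def]
  have hgeom := geom_sum₂_mul (algebraMap F (CoordRing q F) P.1.2) (y q F) q
  rw [hstar, ← y_pow_add_y, P.2, map_add, map_pow]
  linear_combination -hgeom

end StarBasis

section KeyEquation

/-- The coefficients `c` of the expansion `∑ c_j z*_j` of
`f (x ^ (q+1) - α ^ (q+1)) / ((x - α) (y - β))`, provided that `f(α, β) = 0`. -/
def pointQuotient (P : Point q F) (f : CoordRing q F) (j : Fin q) : F[X] :=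
  evalY q P.1.2 (y q F ^ (j : ℕ) * f) /ₘ (X - C P.1.1)

lemma X_sub_C_mul_pointQuotient {P : Point q F} {f : CoordRing q F} (hf : evalAt P f = 0)
    (j : Fin q) :
    (X - C P.1.1) * pointQuotient P f j = evalY q P.1.2 (y q F ^ (j : ℕ) * f) := by
  rw [pointQuotient, mul_divByMonic_eq_iff_isRoot, IsRoot.def, eval_evalY, map_mul, hf, mul_zero]

lemma mul_starSum_pointQuotient {P : Point q F} {f : CoordRing q F} (hf : evalAt P f = 0) :
    (x q F - algebraMap F _ P.1.1) * (y q F - algebraMap F _ P.1.2) *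
        starSum q F (pointQuotient P f) =
      f * (x q F ^ (q + 1) - algebraMap F _ (P.1.1 ^ (q + 1))) := by
  have hx : (x q F - algebraMap F _ P.1.1) * starSum q F (pointQuotient P f) =
      f * starSum q F (fun j => C (P.1.2 ^ (j : ℕ))) := by
    calc (x q F - algebraMap F _ P.1.1) * starSum q F (pointQuotient P f)
        = (X - C P.1.1) • starSum q F (pointQuotient P f) := by
          rw [sub_smul, X_smul_eq, C_smul_eq, Algebra.smul_def, sub_mul]
      _ = starSum q F (fun j => evalY q P.1.2 (y q F ^ (j : ℕ) * f)) := by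
          rw [← map_smul]
          exact congrArg _ (funext (X_sub_C_mul_pointQuotient hf))
      _ = f * starSum q F (fun j => C (P.1.2 ^ (j : ℕ))) := by
          simp only [starSum_mul, evalY_y_pow _ (Fin.is_lt _)]
  rw [← y_sub_mul_starSum_C_pow]
  linear_combination (y q F - algebraMap F _ P.1.2) * hx

lemma x_sub_ne_zero (α : F) : x q F - algebraMap F _ α ≠ 0 := by
  have h : x q F - algebraMap F _ α = AdjoinRoot.mk (curvePoly q F) (C (X - C α)) := by
    rw [C_sub, map_sub]; rfl
  rw [h]
  refine AdjoinRoot.mk_ne_zero_of_natDegree_lt (curvePoly_monic q F)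
    (C_ne_zero.2 (X_sub_C_ne_zero α)) ?_
  rw [natDegree_C, natDegree_curvePoly]
  exact NeZero.pos q

lemma y_sub_ne_zero (β : F) : y q F - algebraMap F _ β ≠ 0 := by
  have h : y q F - algebraMap F _ β = AdjoinRoot.mk (curvePoly q F) (X - C (C β)) := by
    rw [map_sub]; rfl
  rw [h]
  refine AdjoinRoot.mk_ne_zero_of_natDegree_lt (curvePoly_monic q F) (X_sub_C_ne_zero _) ?_
  rw [natDegree_X_sub_C, natDegree_curvePoly]
  exact one_lt_of_primePow q

/-- The coefficient of `x ^ (-a-1) z*_b` in `∑ c_j z*_j`, where `x ^ a y ^ b` is the Laurent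
monomial of order `n`. -/
def numeratorCoeff (n : ℤ) : (Fin q → F[X]) →ₗ[F] F :=
  intCoeff (-xExp q n - 1) ∘ₗ LinearMap.proj (yExp q n)

lemma numeratorCoeff_apply (n : ℤ) (c : Fin q → F[X]) :
    numeratorCoeff n c = intCoeff (-xExp q n - 1) (c (yExp q n)) := rfl

variable [Fintype F] (e : Point q F → F)

open Classical in
/-- The coefficients `c` of the expansion `f S = ∑ c_j z*_j`, provided that `f ∈ I ^ e`. -/
def syndromeNumerator (f : CoordRing q F) : Fin q → F[X] :=
  ∑ P : Point q F, e P • pointQuotient P f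

variable {e} {f : CoordRing q F}

open Classical in
lemma solvesKeyEquation_starSum_syndromeNumerator (hf : f ∈ locatorIdeal e) :
    SolvesKeyEquation e f (starSum q F (syndromeNumerator e f)) := by
  have hsum : starSum q F (syndromeNumerator e f) =
      ∑ P, algebraMap F (CoordRing q F) (e P) * starSum q F (pointQuotient P f) := by
    simp only [syndromeNumerator, map_sum]
    refine Finset.sum_congr rfl fun P _ => ?_
    rw [← Algebra.smul_def, LinearMap.map_smul_of_tower]
  rw [SolvesKeyEquation, syndrome, hsum, Finset.mul_sum, map_sum]
  refine Finset.sum_congr rfl fun P _ => ?_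
  rcases eq_or_ne (e P) 0 with h0 | h0
  · simp [h0]
  have hden := mul_ne_zero (x_sub_ne_zero (q := q) P.1.1) (y_sub_ne_zero P.1.2)
  have hden' := (map_ne_zero_iff _ (IsFractionRing.injective (CoordRing q F) (FunField q F))).2 hden
  have hnum := mul_starSum_pointQuotient (hf P h0)
  rw [mul_div_assoc', mul_div_assoc', div_eq_iff hden', ← map_mul, ← map_mul,
    ← map_mul]
  refine congrArg _ ?_
  linear_combination -(algebraMap F (CoordRing q F) (e P)) * hnum

open Classical in
lemma syndromeCoeff_eq_numeratorCoeff (hf : f ∈ locatorIdeal e) (n : ℤ) :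
    syndromeCoeff e n f = numeratorCoeff n (syndromeNumerator e f) := by
  rw [syndromeCoeff_apply, syndromeNumerator, map_sum]
  refine Finset.sum_congr rfl fun P _ => ?_
  rw [map_smul, smul_eq_mul, numeratorCoeff_apply]
  rcases eq_or_ne (e P) 0 with h0 | h0
  · rw [h0, zero_mul, zero_mul]
  · rw [← X_sub_C_mul_pointQuotient (hf P h0), laurentCoeff_X_sub_C_mul]

end KeyEquation

section Row

variable (q F) in
/-- A pair `f, φ` with `φ` presented by its coefficients in the `*`-basis over `F[X]`. -/
abbrev Row : Type _ := CoordRing q F × (Fin q → F[X])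

variable (q F) in
/-- The pair `f, φ` presented by a row. -/
def rowPair : Row q F →ₗ[F[X]] CoordRing q F × CoordRing q F :=
  LinearMap.id.prodMap (starSum q F)

variable [Fintype F] (e : Point q F → F)

/-- The coefficient of `x ^ (-a-1) z*_b` in `f S - φ`, where `x ^ a y ^ b` is the Laurent monomial
of order `n`. The algorithm annihilates these coefficients for increasing `n`. -/
def residual (n : ℤ) : Row q F →ₗ[F] F :=
  syndromeCoeff e n ∘ₗ LinearMap.fst F _ _ - numeratorCoeff n ∘ₗ LinearMap.snd F _ _

lemma residual_apply (n : ℤ) (u : Row q F) :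
    residual e n u = syndromeCoeff e n u.1 - numeratorCoeff n u.2 := rfl

omit [Fintype F] in
lemma numeratorCoeff_X_pow_smul (n : ℤ) (p : ℕ) (c : Fin q → F[X]) :
    numeratorCoeff n ((X ^ p : F[X]) • c) = numeratorCoeff (n + p * q) c := by
  simp only [numeratorCoeff_apply, Pi.smul_apply, smul_eq_mul, intCoeff_X_pow_mul, xExp_add_mul,
    yExp_add_mul]
  congr 2
  ring

lemma residual_X_pow_smul (n : ℤ) (p : ℕ) (u : Row q F) :
    residual e n ((X ^ p : F[X]) • u) = residual e (n + p * q) u := by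
  rw [residual_apply, residual_apply, Prod.smul_fst, Prod.smul_snd, syndromeCoeff_X_pow_smul,
    numeratorCoeff_X_pow_smul]

lemma residual_monomialOrder (a : ℕ) (b : Fin q) (u : Row q F) :
    residual e (monomialOrder q a b) u = errorSum e ((X ^ a : F[X]) • y q F ^ (b : ℕ) * u.1) := by
  rw [residual_apply, syndromeCoeff_monomialOrder, numeratorCoeff_apply, intCoeff_of_neg, sub_zero]
  rw [xExp_monomialOrder]
  omega

lemma exists_errorSum_mul_eq_add {N : ℤ} {h : CoordRing q F} (hh : h ∈ orderLE q F N) :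
    ∃ h' ∈ orderLE q F (N - 1), ∀ u : Row q F,
      errorSum e (h * u.1) = errorSum e (h' * u.1) + coeffAt N h * residual e N u := by
  rcases lt_or_ge (xExp q N) 0 with hN | hN
  · have h0 : coeffAt N h = 0 := intCoeff_of_neg hN _
    exact ⟨h, mem_orderLE_sub_one hh h0, fun u => by rw [h0, zero_mul, add_zero]⟩
  obtain ⟨a, ha⟩ := Int.eq_ofNat_of_zero_le hN
  have hmono : N = monomialOrder q a (yExp q N) := eq_monomialOrder_iff.2 ⟨ha, rfl⟩
  set t : CoordRing q F := (X ^ a : F[X]) • y q F ^ (yExp q N : ℕ)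
  have ht : t ∈ orderLE q F N := hmono ▸ X_pow_smul_y_pow_mem_orderLE a (yExp q N)
  have ht1 : coeffAt N t = 1 := by rw [coeffAt_X_pow_smul_y_pow, if_pos hmono]
  have hsub := sub_smul_mem_orderLE_sub_one ht (ht1 ▸ one_ne_zero) hh
  rw [ht1, div_one] at hsub
  refine ⟨_, hsub, fun u => ?_⟩
  have hres : residual e N u = errorSum e (t * u.1) := by
    rw [hmono, residual_monomialOrder]
  rw [hres, sub_mul, map_sub, smul_mul_assoc, map_smul, smul_eq_mul, sub_add_cancel]

variable {e}

lemma errorSum_mul_eq_zero {u : Row q F} {N : ℕ} (hu : ∀ n < (N : ℤ), residual e n u = 0)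
    {h : CoordRing q F} (hh : h ∈ orderLE q F (N - 1)) : errorSum e (h * u.1) = 0 := by
  induction N generalizing h with
  | zero => rw [eq_zero_of_mem_orderLE_of_neg (by simp) hh, zero_mul, map_zero]
  | succ N ih =>
    obtain ⟨h', hh', heq⟩ := exists_errorSum_mul_eq_add e hh
    rw [Nat.cast_succ, add_sub_cancel_right] at hh' heq
    rw [heq, ih (fun n hn => hu n (by omega)) hh', hu N (by simp), mul_zero, add_zero]

lemma errorSum_mul_eq {u : Row q F} {N : ℕ} (hu : ∀ n < (N : ℤ), residual e n u = 0)
    {h : CoordRing q F} (hh : h ∈ orderLE q F N) :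
    errorSum e (h * u.1) = coeffAt N h * residual e N u := by
  obtain ⟨h', hh', heq⟩ := exists_errorSum_mul_eq_add e hh
  rw [heq, errorSum_mul_eq_zero hu hh', zero_add]

end Row

section LocatorAuxiliary

variable [Fintype F] {e : Point q F → F}

/-- The row `u` presents a pair `f, φ` with `f` of order `d` and leading coefficient `1`, that
solves the key equation approximately: all monomials of `f S` of order less than `m - d` agree with
those of `φ`, and `φ` has no others. -/
structure IsLocator (e : Point q F → F) (m d : ℤ) (u : Row q F) : Prop where
  mem_orderLE : u.1 ∈ orderLE q F d
  coeffAt_eq_one : coeffAt d u.1 = 1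
  residual_eq_zero : ∀ n < m - d, residual e n u = 0
  numeratorCoeff_eq_zero : ∀ n ≥ m - d, numeratorCoeff n u.2 = 0

/-- The row `v` presents a pair `g, ψ` for which `g S - ψ` starts with the monomial of order `D`,
with coefficient `1`, so that it can correct the residual of a locator; the bound on the order of
`g` makes such a correction leave the leading term of the locator alone. -/
structure IsAuxiliary (e : Point q F → F) (m D : ℤ) (v : Row q F) : Prop where
  mem_orderLE : v.1 ∈ orderLE q F (m - D - 1)
  residual_eq_one : residual e D v = 1
  residual_eq_zero : ∀ n < D, residual e n v = 0
  numeratorCoeff_eq_zero : ∀ n > D, numeratorCoeff n v.2 = 0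

lemma isLocator_y_pow (i : Fin q) :
    IsLocator e 0 (monomialOrder q 0 i) ((y q F ^ (i : ℕ), 0) : Row q F) where
  mem_orderLE := by simpa using X_pow_smul_y_pow_mem_orderLE (F := F) 0 i
  coeffAt_eq_one := by simpa using coeffAt_X_pow_smul_y_pow (F := F) (monomialOrder q 0 i) 0 i
  residual_eq_zero n hn := by
    rw [residual_apply, map_zero, sub_zero]
    refine syndromeCoeff_y_pow_eq_zero e i (hn.trans_eq ?_)
    rw [monomialOrder]
    ring
  numeratorCoeff_eq_zero n _ := map_zero _

omit [Fintype F] in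
lemma numeratorCoeff_single (n : ℤ) (i : Fin q) :
    numeratorCoeff n (Pi.single i (1 : F[X])) = if n = monomialOrder q (-1) i then 1 else 0 := by
  rw [numeratorCoeff_apply, Pi.single_apply, apply_ite (intCoeff (R := F) _), map_zero,
    ← pow_zero X, intCoeff_X_pow, ← ite_and]
  refine if_congr ?_ rfl rfl
  rw [eq_monomialOrder_iff, and_comm, Nat.cast_zero]
  exact and_congr_left fun _ => by omega

lemma isAuxiliary_neg_single (i : Fin q) :
    IsAuxiliary e 0 (monomialOrder q (-1) i) ((0, -Pi.single i 1) : Row q F) where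
  mem_orderLE := zero_mem _
  residual_eq_one := by simp [residual_apply, numeratorCoeff_single]
  residual_eq_zero n hn := by simp [residual_apply, numeratorCoeff_single, hn.ne]
  numeratorCoeff_eq_zero n hn := by simp [numeratorCoeff_single, hn.ne']

namespace IsLocator

variable {m d : ℤ} {u : Row q F}

lemma rhoInt_eq (hu : IsLocator e m d u) : rhoInt u.1 = d :=
  Hermitian.rhoInt_eq hu.mem_orderLE (hu.coeffAt_eq_one ▸ one_ne_zero)

lemma nonneg (hu : IsLocator e m d u) : 0 ≤ d := hu.rhoInt_eq ▸ Int.natCast_nonneg _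

lemma residual_eq_syndromeCoeff (hu : IsLocator e m d u) :
    residual e (m - d) u = syndromeCoeff e (m - d) u.1 := by
  rw [residual_apply, hu.numeratorCoeff_eq_zero _ le_rfl, sub_zero]

lemma succ (hu : IsLocator e m d u) (h0 : residual e (m - d) u = 0) : IsLocator e (m + 1) d u where
  mem_orderLE := hu.mem_orderLE
  coeffAt_eq_one := hu.coeffAt_eq_one
  residual_eq_zero n hn := (eq_or_ne n (m - d)).elim (fun h => h ▸ h0)
    fun h => hu.residual_eq_zero n (by omega)
  numeratorCoeff_eq_zero n hn := hu.numeratorCoeff_eq_zero n (by omega)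

lemma sub_smul {D : ℤ} {v : Row q F} (hu : IsLocator e m d u) (hv : IsAuxiliary e m D v) {k l : ℕ}
    (hkl : m - d - k * q = D - l * q) :
    IsLocator e (m + 1) (d + k * q)
      ((X ^ k : F[X]) • u - residual e (m - d) u • (X ^ l : F[X]) • v) where
  mem_orderLE := sub_mem (X_pow_smul_mem_orderLE hu.mem_orderLE k) <| Submodule.smul_mem _ _ <|
    orderLE_mono (by omega) (X_pow_smul_mem_orderLE hv.mem_orderLE l)
  coeffAt_eq_one := by
    have hlow := Hermitian.mem_orderLE.1 hv.mem_orderLE (d + k * q - l * q) (by omega)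
    simp [coeffAt_X_pow_smul, hu.coeffAt_eq_one, hlow]
  residual_eq_zero n hn := by
    rw [map_sub, residual_X_pow_smul, map_smul, residual_X_pow_smul]
    rcases eq_or_ne (n + k * q) (m - d) with h | h
    · rw [h, show n + l * q = D by omega, hv.residual_eq_one, smul_eq_mul, mul_one, sub_self]
    · rw [hu.residual_eq_zero _ (by omega), hv.residual_eq_zero _ (by omega), smul_zero, sub_zero]
  numeratorCoeff_eq_zero n hn := by
    rw [Prod.snd_sub, Prod.smul_snd, Prod.smul_snd, Prod.smul_snd, map_sub,
      numeratorCoeff_X_pow_smul, map_smul, numeratorCoeff_X_pow_smul,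
      hu.numeratorCoeff_eq_zero _ (by omega), hv.numeratorCoeff_eq_zero _ (by omega), smul_zero,
      sub_zero]

lemma isAuxiliary_inv_smul (hu : IsLocator e m d u) (h0 : residual e (m - d) u ≠ 0) :
    IsAuxiliary e (m + 1) (m - d) ((residual e (m - d) u)⁻¹ • u) where
  mem_orderLE := Submodule.smul_mem _ _ (orderLE_mono (by omega) hu.mem_orderLE)
  residual_eq_one := by rw [map_smul, smul_eq_mul, inv_mul_cancel₀ h0]
  residual_eq_zero n hn := by rw [map_smul, hu.residual_eq_zero n hn, smul_zero]
  numeratorCoeff_eq_zero n hn := by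
    rw [Prod.smul_snd, map_smul, hu.numeratorCoeff_eq_zero n hn.le, smul_zero]

lemma errorSum_X_pow_smul_mul {d' : ℤ} {u' : Row q F} (hu : IsLocator e m d u)
    (hu' : IsLocator e m d' u') {p : ℕ} (hp : m - d - d' = p * q) :
    errorSum e ((X ^ p : F[X]) • u'.1 * u.1) = residual e (m - d) u := by
  have hpos : 0 ≤ m - d := by
    have := hu'.nonneg
    have : 0 ≤ (p : ℤ) * q := by positivity
    omega
  have hd : d' + p * q = m - d := by omega
  have hmem := X_pow_smul_mem_orderLE hu'.mem_orderLE p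
  have hone := hu'.coeffAt_eq_one
  have hzero := hu.residual_eq_zero
  rw [hd] at hmem
  rw [show d' = m - d - p * q by omega, ← coeffAt_X_pow_smul] at hone
  generalize m - d = N at *
  lift N to ℕ using hpos
  rw [errorSum_mul_eq hzero hmem, hone, one_mul]

lemma residual_comm {d' : ℤ} {u' : Row q F} (hu : IsLocator e m d u) (hu' : IsLocator e m d' u')
    {p : ℕ} (hp : m - d - d' = p * q) : residual e (m - d) u = residual e (m - d') u' := by
  rw [← hu.errorSum_X_pow_smul_mul hu' hp, ← hu'.errorSum_X_pow_smul_mul hu (p := p) (by omega),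
    smul_mul_assoc, smul_mul_assoc, mul_comm]

end IsLocator

lemma IsAuxiliary.succ {m D : ℤ} {v : Row q F} (hv : IsAuxiliary e m D v) :
    IsAuxiliary e (m + 1) D v where
  mem_orderLE := orderLE_mono (by omega) hv.mem_orderLE
  residual_eq_one := hv.residual_eq_one
  residual_eq_zero := hv.residual_eq_zero
  numeratorCoeff_eq_zero := hv.numeratorCoeff_eq_zero

end LocatorAuxiliary

section Invariant

lemma yExp_natCast_sub (m : ℕ) (d : ℤ) : yExp q (m - d) = partner m (yExp q d) := by
  refine eq_partner ((Int.natCast_modEq_iff).1 ?_)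
  rw [Nat.cast_add, coe_yExp, coe_yExp]
  calc d % q + (m - d) % q ≡ d + (m - d) [ZMOD q] := (Int.mod_modEq _ _).add (Int.mod_modEq _ _)
    _ = m := add_sub_cancel _ _

omit [Fact (IsPrimePow q)] in
lemma partner_partner (m : ℕ) (i : Fin q) : partner m (partner m i) = i :=
  (eq_partner (by rw [add_comm]; exact add_partner_modEq m i)).symm

/-- The state in which the algorithm enters iteration `m`: the order of `f_i` is congruent to `i`
modulo `q`, `f_i, φ_i` is a locator pair, and `g_i, ψ_i` is an auxiliary pair that became one when
the order of `f_i` was last raised. -/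
structure KeyInvariant [Fintype F] (e : Point q F → F) (m : ℕ) (st : State q F) : Prop where
  yExp_rhoInt i : yExp q (rhoInt (st.f i)) = i
  exists_isLocator i :
    ∃ u, rowPair q F u = (st.f i, st.φ i) ∧ IsLocator e m (rhoInt (st.f i)) u
  exists_isAuxiliary i :
    ∃ v, rowPair q F v = (st.g i, st.ψ i) ∧ IsAuxiliary e m (rhoInt (st.f i) - q) v

lemma keyInvariant_initState [Fintype F] (e : Point q F → F) :
    KeyInvariant e 0 (initState q F) := by
  have hrho (i : Fin q) : rhoInt ((initState q F).f i) = monomialOrder q 0 i :=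
    (isLocator_y_pow (e := e) i).rhoInt_eq
  refine ⟨fun i => ?_, fun i => ?_, fun i => ?_⟩
  · rw [hrho, yExp_monomialOrder]
  · exact ⟨(y q F ^ (i : ℕ), 0), by simp [rowPair, initState], hrho i ▸ isLocator_y_pow i⟩
  · have hD : monomialOrder q 0 i - q = monomialOrder q (-1) i := by
      rw [monomialOrder, monomialOrder]
      ring
    refine ⟨(0, -Pi.single i 1), by simp [rowPair, initState, starSum], ?_⟩
    rw [hrho, hD]
    exact isAuxiliary_neg_single i

variable [Fintype F] {e : Point q F → F} {m : ℕ} {st : State q F} {i j : Fin q} {u v : Row q F}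

lemma rowPair_updateBlock_of_eq_zero_or_gap_nonneg
    (h : discrepancy e m st i j = 0 ∨ 0 ≤ gap m st i j)
    (hu : rowPair q F u = (st.f i, st.φ i)) (hv : rowPair q F v = (st.g j, st.ψ j)) :
    rowPair q F (u - discrepancy e m st i j • (X ^ (gap m st i j).toNat : F[X]) • v) =
        (updateBlock e m st i j 0 0, updateBlock e m st i j 0 1) ∧
      rowPair q F v = (updateBlock e m st i j 1 0, updateBlock e m st i j 1 1) := by
  simp only [map_sub, LinearMap.map_smul_of_tower (R := F), map_smul, hu, hv,
    Prod.smul_mk, X_pow_smul_eq, updateBlock, updateMatrix, if_pos h, Matrix.mul_fin_two]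
  simp [Algebra.smul_def, sub_eq_add_neg, mul_assoc]

lemma rowPair_updateBlock_of_not
    (h : ¬(discrepancy e m st i j = 0 ∨ 0 ≤ gap m st i j))
    (hu : rowPair q F u = (st.f i, st.φ i)) (hv : rowPair q F v = (st.g j, st.ψ j)) :
    rowPair q F ((X ^ (-gap m st i j).toNat : F[X]) • u - discrepancy e m st i j • v) =
        (updateBlock e m st i j 0 0, updateBlock e m st i j 0 1) ∧
      rowPair q F ((discrepancy e m st i j)⁻¹ • u) =
        (updateBlock e m st i j 1 0, updateBlock e m st i j 1 1) := by
  simp only [map_sub, LinearMap.map_smul_of_tower (R := F), map_smul, hu, hv,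
    Prod.smul_mk, X_pow_smul_eq, updateBlock, updateMatrix, if_neg h, Matrix.mul_fin_two]
  simp [Algebra.smul_def, sub_eq_add_neg]

namespace KeyInvariant

lemma add_sub_eq_gap_mul (h : KeyInvariant e m st) (hij : partner m i = j) :
    rhoInt (st.f i) + rhoInt (st.f j) - m = (gap m st i j + 1) * q := by
  have hmod : rhoInt (st.f j) % q = (m - rhoInt (st.f i)) % q := by
    rw [← coe_yExp, ← coe_yExp, h.yExp_rhoInt, yExp_natCast_sub, h.yExp_rhoInt, hij]
  have hdvd : (q : ℤ) ∣ rhoInt (st.f i) + rhoInt (st.f j) - m := by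
    have := (Int.ModEq.symm hmod).dvd
    convert this using 1
    ring
  rw [gap, sub_add_cancel, Int.ediv_mul_cancel hdvd]

lemma monomialOrder_shift (h : KeyInvariant e m st) (hij : partner m i = j) :
    monomialOrder q (shift m st i j) j = m - rhoInt (st.f i) := by
  have hq : (q : ℤ) ≠ 0 := by exact_mod_cast NeZero.ne q
  have hn := monomialOrder_xExp_yExp (q := q) (m - rhoInt (st.f i))
  rw [yExp_natCast_sub, h.yExp_rhoInt, hij] at hn
  rw [shift, ← hn, monomialOrder, monomialOrder, add_sub_cancel_right, Int.mul_ediv_cancel _ hq]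

lemma discrepancy_eq_residual (h : KeyInvariant e m st) (hij : partner m i = j)
    (hu : rowPair q F u = (st.f i, st.φ i)) (hloc : IsLocator e m (rhoInt (st.f i)) u) :
    discrepancy e m st i j = residual e (m - rhoInt (st.f i)) u := by
  have hfst : u.1 = st.f i := congrArg Prod.fst hu
  rw [discrepancy_eq_syndromeCoeff, h.monomialOrder_shift hij, hloc.residual_eq_syndromeCoeff, hfst]

lemma discrepancy_comm (h : KeyInvariant e m st) (hij : partner m i = j) (hgap : gap m st i j < 0) :
    discrepancy e m st i j = discrepancy e m st j i := by
  have hji : partner m j = i := hij ▸ partner_partner m i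
  obtain ⟨u, hu, hloc⟩ := h.exists_isLocator i
  obtain ⟨u', hu', hloc'⟩ := h.exists_isLocator j
  obtain ⟨p, hp⟩ := Int.eq_ofNat_of_zero_le (a := -(gap m st i j + 1)) (by omega)
  rw [h.discrepancy_eq_residual hij hu hloc, h.discrepancy_eq_residual hji hu' hloc']
  refine hloc.residual_comm hloc' (p := p) ?_
  linear_combination -h.add_sub_eq_gap_mul hij + (q : ℤ) * hp

lemma isLocator_of_eq_zero_or_gap_nonneg (h : KeyInvariant e m st) (hij : partner m i = j)
    (hc : discrepancy e m st i j = 0 ∨ 0 ≤ gap m st i j)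
    (hu : rowPair q F u = (st.f i, st.φ i)) (hloc : IsLocator e m (rhoInt (st.f i)) u)
    (haux : IsAuxiliary e m (rhoInt (st.f j) - q) v) :
    IsLocator e (m + 1) (rhoInt (st.f i))
      (u - discrepancy e m st i j • (X ^ (gap m st i j).toNat : F[X]) • v) := by
  have hμ := h.discrepancy_eq_residual hij hu hloc
  rcases lt_or_ge (gap m st i j) 0 with hgap | hgap
  · have h0 := hc.resolve_right hgap.not_ge
    rw [h0, zero_smul, sub_zero]
    exact hloc.succ (hμ.symm.trans h0)
  · have hkl : m - rhoInt (st.f i) - (0 : ℕ) * q =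
        rhoInt (st.f j) - q - (gap m st i j).toNat * q := by
      rw [Int.toNat_of_nonneg hgap, Nat.cast_zero]
      linear_combination -h.add_sub_eq_gap_mul hij
    simpa only [hμ, pow_zero, one_smul, Nat.cast_zero, zero_mul, add_zero] using
      hloc.sub_smul haux hkl

lemma isLocator_of_gap_neg (h : KeyInvariant e m st) (hij : partner m i = j)
    (hgap : gap m st i j < 0) (hu : rowPair q F u = (st.f i, st.φ i))
    (hloc : IsLocator e m (rhoInt (st.f i)) u)
    (haux : IsAuxiliary e m (rhoInt (st.f j) - q) v) :
    IsLocator e (m + 1) (m - rhoInt (st.f j) + q)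
      ((X ^ (-gap m st i j).toNat : F[X]) • u - discrepancy e m st i j • v) := by
  have hsum := h.add_sub_eq_gap_mul hij
  have hcast : ((-gap m st i j).toNat : ℤ) = -gap m st i j := Int.toNat_of_nonneg (by omega)
  have hkl : m - rhoInt (st.f i) - (-gap m st i j).toNat * q =
      rhoInt (st.f j) - q - (0 : ℕ) * q := by
    rw [hcast, Nat.cast_zero]
    linear_combination -hsum
  have hd : rhoInt (st.f i) + (-gap m st i j).toNat * q = m - rhoInt (st.f j) + q := by
    rw [hcast]
    linear_combination hsum
  simpa only [h.discrepancy_eq_residual hij hu hloc, pow_zero, one_smul, hd] using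
    hloc.sub_smul haux hkl

end KeyInvariant

open Classical in
/-- The order of `f_i` after iteration `m`. It changes exactly when `U_i` is not unitriangular. -/
def nextOrder (e : Point q F → F) (m : ℕ) (st : State q F) (i : Fin q) : ℤ :=
  if discrepancy e m st i (partner m i) = 0 ∨ 0 ≤ gap m st i (partner m i) then rhoInt (st.f i)
  else m - rhoInt (st.f (partner m i)) + q

namespace KeyInvariant

lemma eq_zero_or_gap_nonneg_comm (h : KeyInvariant e m st) (hij : partner m i = j) :
    (discrepancy e m st i j = 0 ∨ 0 ≤ gap m st i j) ↔
      (discrepancy e m st j i = 0 ∨ 0 ≤ gap m st j i) := by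
  have hgap : gap m st j i = gap m st i j := by rw [gap, gap, add_comm (rhoInt (st.f j))]
  rw [hgap]
  rcases lt_or_ge (gap m st i j) 0 with hneg | hpos
  · rw [h.discrepancy_comm hij hneg]
  · simp only [hpos, or_true]

lemma yExp_nextOrder (h : KeyInvariant e m st) (i : Fin q) : yExp q (nextOrder e m st i) = i := by
  rw [nextOrder]
  split_ifs with hc
  · exact h.yExp_rhoInt i
  · have hadd := yExp_add_mul (q := q) (m - rhoInt (st.f (partner m i))) 1
    rw [one_mul] at hadd
    rw [hadd, yExp_natCast_sub, h.yExp_rhoInt, partner_partner]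

lemma exists_isLocator_step (h : KeyInvariant e m st) (i : Fin q) :
    ∃ u, rowPair q F u = ((step e m st).f i, (step e m st).φ i) ∧
      IsLocator e (m + 1) (nextOrder e m st i) u := by
  obtain ⟨u, hu, hloc⟩ := h.exists_isLocator i
  obtain ⟨v, hv, haux⟩ := h.exists_isAuxiliary (partner m i)
  rw [nextOrder]
  split_ifs with hc
  · exact ⟨_, (rowPair_updateBlock_of_eq_zero_or_gap_nonneg hc hu hv).1,
      h.isLocator_of_eq_zero_or_gap_nonneg rfl hc hu hloc haux⟩
  · exact ⟨_, (rowPair_updateBlock_of_not hc hu hv).1,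
      h.isLocator_of_gap_neg rfl (not_le.1 (not_or.1 hc).2) hu hloc haux⟩

lemma exists_isAuxiliary_step (h : KeyInvariant e m st) (j : Fin q) :
    ∃ v, rowPair q F v = ((step e m st).g j, (step e m st).ψ j) ∧
      IsAuxiliary e (m + 1) (nextOrder e m st j - q) v := by
  have hij := partner_partner m j
  obtain ⟨u, hu, hloc⟩ := h.exists_isLocator (partner m j)
  obtain ⟨v, hv, haux⟩ := h.exists_isAuxiliary j
  rw [nextOrder]
  split_ifs with hc <;> rw [h.eq_zero_or_gap_nonneg_comm rfl] at hc
  · exact ⟨v, (rowPair_updateBlock_of_eq_zero_or_gap_nonneg hc hu hv).2, haux.succ⟩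
  · have hμ := h.discrepancy_eq_residual hij hu hloc
    refine ⟨_, (rowPair_updateBlock_of_not hc hu hv).2, ?_⟩
    rw [add_sub_cancel_right, hμ]
    exact hloc.isAuxiliary_inv_smul (hμ ▸ (not_or.1 hc).1)

lemma step (h : KeyInvariant e m st) : KeyInvariant e (m + 1) (step e m st) := by
  have hrho (i : Fin q) : rhoInt ((Hermitian.step e m st).f i) = nextOrder e m st i := by
    obtain ⟨u, hu, hloc⟩ := h.exists_isLocator_step i
    have hfst : u.1 = (Hermitian.step e m st).f i := congrArg Prod.fst hu
    rw [← hfst, hloc.rhoInt_eq]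
  refine ⟨fun i => ?_, fun i => ?_, fun i => ?_⟩ <;> rw [hrho]
  · exact h.yExp_nextOrder i
  · exact_mod_cast h.exists_isLocator_step i
  · exact_mod_cast h.exists_isAuxiliary_step i

end KeyInvariant

lemma keyInvariant_run (e : Point q F → F) (m : ℕ) : KeyInvariant e m (run e m) := by
  induction m with
  | zero => exact keyInvariant_initState e
  | succ m ih => exact ih.step

end Invariant

section Evaluation

omit [Fact (IsPrimePow q)]

lemma evalAt_x (P : Point q F) : evalAt P (x q F) = P.1.1 := by
  simp [evalAt, x]

lemma evalAt_y (P : Point q F) : evalAt P (y q F) = P.1.2 := by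
  simp [evalAt, y]

lemma evalAt_algebraMap (P : Point q F) (c : F) : evalAt P (algebraMap F _ c) = c := by
  rw [AdjoinRoot.algebraMap_eq', RingHom.comp_apply, evalAt, AdjoinRoot.lift_of, algebraMap_eq,
    coe_evalRingHom, eval_C]

lemma exists_evalAt_eq_zero_ne_zero {P Q : Point q F} (h : Q ≠ P) :
    ∃ f : CoordRing q F, evalAt Q f = 0 ∧ evalAt P f ≠ 0 := by
  by_cases hx : P.1.1 = Q.1.1
  · have hy : P.1.2 ≠ Q.1.2 := fun hy => h (Subtype.ext (Prod.ext hx hy)).symm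
    refine ⟨y q F - algebraMap F _ Q.1.2, ?_, ?_⟩ <;> rw [map_sub, evalAt_y, evalAt_algebraMap]
    exacts [sub_self _, sub_ne_zero.2 hy]
  · refine ⟨x q F - algebraMap F _ Q.1.1, ?_, ?_⟩ <;> rw [map_sub, evalAt_x, evalAt_algebraMap]
    exacts [sub_self _, sub_ne_zero.2 hx]

end Evaluation

section LocatorIdeal

variable [Fintype F] {e : Point q F → F} {f : CoordRing q F}

lemma errorSum_eq_zero (hf : f ∈ locatorIdeal e) : errorSum e f = 0 := by
  classical
  rw [errorSum_apply]
  refine Finset.sum_eq_zero fun P _ => ?_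
  rcases eq_or_ne (e P) 0 with h0 | h0
  · rw [h0, zero_mul]
  · rw [hf P h0, mul_zero]

lemma mem_locatorIdeal_iff_errorSum :
    f ∈ locatorIdeal e ↔ ∀ h, errorSum e (h * f) = 0 := by
  classical
  refine ⟨fun hf h => errorSum_eq_zero (Ideal.mul_mem_left _ h hf), fun hf P hP => ?_⟩
  choose! sep hsep using fun Q hQ => exists_evalAt_eq_zero_ne_zero (P := P) (Q := Q) hQ
  have hsum := hf (∏ Q ∈ Finset.univ.erase P, sep Q)
  rw [errorSum_apply, Finset.sum_eq_single_of_mem P (Finset.mem_univ P), map_mul, map_prod] at hsum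
  · have hprod : ∏ Q ∈ Finset.univ.erase P, evalAt P (sep Q) ≠ 0 :=
      Finset.prod_ne_zero_iff.2 fun Q hQ => (hsep Q (Finset.ne_of_mem_erase hQ)).2
    exact (mul_eq_zero.1 ((mul_eq_zero.1 hsum).resolve_left hP)).resolve_left hprod
  · intro Q _ hQ
    have hmem : Q ∈ Finset.univ.erase P := Finset.mem_erase.2 ⟨hQ, Finset.mem_univ Q⟩
    rw [map_mul, map_prod, Finset.prod_eq_zero hmem (hsep Q hQ).1, zero_mul, mul_zero]

end LocatorIdeal

section Footprint

variable {I : Ideal (CoordRing q F)}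

lemma mem_ordersOf_iff {n : ℕ} :
    n ∈ ordersOf I ↔ ∃ f ∈ I, f ∈ orderLE q F n ∧ coeffAt n f ≠ 0 := by
  simp only [ordersOf, Set.mem_ofPred_eq, rho_eq_iff]

lemma add_mul_mem_ordersOf {n : ℕ} (hn : n ∈ ordersOf I) (p : ℕ) : n + p * q ∈ ordersOf I := by
  obtain ⟨f, hfI, hf, h0⟩ := mem_ordersOf_iff.1 hn
  refine mem_ordersOf_iff.2 ⟨(X ^ p : F[X]) • f, ?_, ?_, ?_⟩
  · rw [X_pow_smul_eq]
    exact I.mul_mem_left _ hfI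
  · exact_mod_cast X_pow_smul_mem_orderLE hf p
  · rw [coeffAt_X_pow_smul]
    simpa using h0

lemma exists_natCast_mem_orderLE (f : CoordRing q F) : ∃ N : ℕ, f ∈ orderLE q F N := by
  obtain ⟨N, hN⟩ : ∃ N : ℕ, rho f < N := by
    cases h : rho f with
    | bot => exact ⟨0, WithBot.bot_lt_coe 0⟩
    | coe n => exact ⟨n + 1, WithBot.coe_lt_coe.2 n.lt_succ_self⟩
  exact ⟨N, orderLE_mono (by omega) (rho_lt_iff.1 hN)⟩

lemma exists_mem_orderLE_sub_mem {δ : ℕ} (hδ : ∀ n ∈ orders q F \ ordersOf I, n ≤ δ)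
    (u : CoordRing q F) : ∃ w ∈ orderLE q F δ, u - w ∈ I := by
  obtain ⟨N, hN⟩ := exists_natCast_mem_orderLE u
  induction N generalizing u with
  | zero => exact ⟨u, orderLE_mono (by omega) hN, by rw [sub_self]; exact I.zero_mem⟩
  | succ N ih =>
    rcases le_or_gt (N + 1) δ with hle | hgt
    · exact ⟨u, orderLE_mono (by exact_mod_cast hle) hN, by rw [sub_self]; exact I.zero_mem⟩
    have hpred : ((N + 1 : ℕ) : ℤ) - 1 = N := by simp
    by_cases h0 : coeffAt (N + 1 : ℕ) u = 0
    · exact ih u (hpred ▸ mem_orderLE_sub_one hN h0)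
    have hord : N + 1 ∈ ordersOf I := by
      by_contra hI
      exact hgt.not_ge (hδ _ ⟨⟨u, rho_eq_iff.2 ⟨hN, h0⟩⟩, hI⟩)
    obtain ⟨f, hfI, hf, hf0⟩ := mem_ordersOf_iff.1 hord
    obtain ⟨w, hw, hwI⟩ := ih _ (hpred ▸ sub_smul_mem_orderLE_sub_one hf hf0 hN)
    refine ⟨w, hw, ?_⟩
    have := I.add_mem hwI (I.smul_of_tower_mem (coeffAt (N + 1 : ℕ) u / coeffAt (N + 1 : ℕ) f) hfI)
    rwa [sub_right_comm, sub_add_cancel] at this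

variable [Finite F] (e : Point q F → F)

lemma nonempty_residueOrders (i : Fin q) : (residueOrders e i).Nonempty := by
  have := Fintype.ofFinite F
  set n := Fintype.card F * q + i * (q + 1) with hn
  have hmono : (n : ℤ) = monomialOrder q (Fintype.card F : ℕ) i := by
    rw [hn, monomialOrder]
    push_cast
    rfl
  have hlt : monomialOrder q (1 : ℕ) i < n := by
    rw [hmono, monomialOrder, monomialOrder, add_lt_add_iff_right]
    exact mul_lt_mul_of_pos_right (by exact_mod_cast Fintype.one_lt_card)
      (by exact_mod_cast NeZero.pos q)
  refine ⟨n, mem_ordersOf_iff.2 ⟨(X ^ Fintype.card F : F[X]) • y q F ^ (i : ℕ) -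
    (X ^ 1 : F[X]) • y q F ^ (i : ℕ), ?_, ?_, ?_⟩, ?_⟩
  · intro P _
    rw [X_pow_smul_eq, X_pow_smul_eq, ← sub_mul, map_mul, map_sub, map_pow, map_pow, evalAt_x,
      FiniteField.pow_card, pow_one, sub_self, zero_mul]
  · refine sub_mem ?_ (orderLE_mono hlt.le (X_pow_smul_y_pow_mem_orderLE 1 i))
    rw [hmono]
    exact X_pow_smul_y_pow_mem_orderLE _ i
  · rw [map_sub, coeffAt_X_pow_smul_y_pow, coeffAt_X_pow_smul_y_pow, if_pos hmono, if_neg hlt.ne',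
      sub_zero]
    exact one_ne_zero
  · have : n = i + (Fintype.card F + i) * q := by rw [hn]; ring
    rw [this]
    exact Nat.add_mul_modulus_modEq_iff.2 rfl

lemma isLeast_sigma (i : Fin q) : IsLeast (residueOrders e i) (sigma e i) :=
  ⟨Nat.sInf_mem (nonempty_residueOrders e i), fun _ => Nat.sInf_le⟩

variable {e}

lemma mem_ordersOf_of_sigma_le {n : ℕ} {i : Fin q} (hn : n ≡ i [MOD q]) (h : sigma e i ≤ n) :
    n ∈ ordersOf (locatorIdeal e) := by
  obtain ⟨hσ, hσi⟩ := (isLeast_sigma e i).1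
  obtain ⟨p, hp⟩ := (Nat.modEq_iff_dvd' h).1 (hσi.trans hn.symm)
  have := add_mul_mem_ordersOf hσ p
  rwa [mul_comm, ← hp, Nat.add_sub_cancel' h] at this

omit [Finite F] in
lemma sigma_le_sigmaMax (i : Fin q) : sigma e i ≤ sigmaMax e := Finset.le_sup (Finset.mem_univ i)

lemma lt_sigmaMax_of_mem_footprint {n : ℕ} (hn : n ∈ footprint e) : n < sigmaMax e := by
  by_contra! h
  exact hn.2 (mem_ordersOf_of_sigma_le (i := ⟨n % q, Nat.mod_lt _ (NeZero.pos q)⟩)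
    (Nat.mod_modEq n q).symm ((sigma_le_sigmaMax _).trans h))

omit [Finite F] in
lemma zero_mem_footprint (he : e ≠ 0) : 0 ∈ footprint e := by
  have hone : (1 : CoordRing q F) ∈ orderLE q F (0 : ℕ) := by
    simpa [monomialOrder] using X_pow_smul_y_pow_mem_orderLE (F := F) 0 (0 : Fin q)
  have hcoeff : coeffAt (0 : ℕ) (1 : CoordRing q F) = 1 := by
    simpa [monomialOrder] using coeffAt_X_pow_smul_y_pow (F := F) 0 0 (0 : Fin q)
  refine ⟨⟨1, rho_eq_iff.2 ⟨hone, hcoeff ▸ one_ne_zero⟩⟩, fun h => ?_⟩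
  obtain ⟨f, hfI, hf, h0⟩ := mem_ordersOf_iff.1 h
  have hsub := eq_zero_of_mem_orderLE_of_neg (by simp) (sub_smul_mem_orderLE_sub_one hf h0 hone)
  have hmem : (1 : CoordRing q F) ∈ locatorIdeal e :=
    sub_eq_zero.1 hsub ▸ Submodule.smul_of_tower_mem _ _ hfI
  obtain ⟨P, hP⟩ := Function.ne_iff.1 he
  exact one_ne_zero ((map_one (evalAt P)).symm.trans (hmem P hP))

lemma bddAbove_footprint : BddAbove (footprint e) :=
  ⟨sigmaMax e, fun _ hn => (lt_sigmaMax_of_mem_footprint hn).le⟩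

lemma isGreatest_deltaMax (he : e ≠ 0) : IsGreatest (footprint e) (deltaMax e) :=
  ⟨Nat.sSup_mem ⟨0, zero_mem_footprint he⟩ bddAbove_footprint,
    fun _ => le_csSup bddAbove_footprint⟩

end Footprint

section Correctness

lemma eq_of_numeratorCoeff_eq {c c' : Fin q → F[X]}
    (h : ∀ n ≤ (q : ℤ) ^ 2 - q - 1, numeratorCoeff n c = numeratorCoeff n c') : c = c' := by
  ext j k
  have hn : monomialOrder q (-k - 1) j ≤ (q : ℤ) ^ 2 - q - 1 := by
    have hj : ((j : ℕ) : ℤ) + 1 ≤ q := by exact_mod_cast j.isLt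
    have hk : 0 ≤ (k : ℤ) * q := by positivity
    rw [monomialOrder]
    nlinarith
  have := h _ hn
  rwa [numeratorCoeff_apply, numeratorCoeff_apply, xExp_monomialOrder, yExp_monomialOrder, neg_sub,
    sub_neg_eq_add, add_sub_cancel_left, intCoeff_natCast, intCoeff_natCast] at this

variable [Fintype F] {e : Point q F → F}

namespace IsLocator

variable {m d : ℤ} {u : Row q F}

lemma mem_locatorIdeal (hu : IsLocator e m d u) {δ : ℕ} (hδ : ∀ n ∈ footprint e, n ≤ δ)
    (hm : d + δ < m) : u.1 ∈ locatorIdeal e := by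
  refine mem_locatorIdeal_iff_errorSum.2 fun h => ?_
  obtain ⟨w, hw, hI⟩ := exists_mem_orderLE_sub_mem hδ h
  have hres : ∀ n < ((δ + 1 : ℕ) : ℤ), residual e n u = 0 :=
    fun n hn => hu.residual_eq_zero n (by omega)
  have hw0 : errorSum e (w * u.1) = 0 := errorSum_mul_eq_zero hres (by simpa using hw)
  have hI0 : errorSum e ((h - w) * u.1) = 0 := errorSum_eq_zero (Ideal.mul_mem_right _ _ hI)
  rw [← sub_add_cancel h w, add_mul, map_add, hw0, hI0, add_zero]

lemma solvesKeyEquation (hu : IsLocator e m d u) (hmem : u.1 ∈ locatorIdeal e)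
    (hm : d + ((q : ℤ) ^ 2 - q - 1) < m) :
    SolvesKeyEquation e (rowPair q F u).1 (rowPair q F u).2 := by
  have hnum : u.2 = syndromeNumerator e u.1 := eq_of_numeratorCoeff_eq fun n hn => by
    rw [← syndromeCoeff_eq_numeratorCoeff hmem, eq_comm, ← sub_eq_zero]
    exact hu.residual_eq_zero n (by linarith)
  have hkey := solvesKeyEquation_starSum_syndromeNumerator hmem
  rwa [← hnum] at hkey

end IsLocator

lemma IsAuxiliary.lt_of_mem_ordersOf {m D : ℤ} {v : Row q F} (hv : IsAuxiliary e m D v) {n : ℕ}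
    (hn : n ∈ ordersOf (locatorIdeal e)) (hmod : n ≡ D [ZMOD q]) : D < n := by
  by_contra! hle
  lift D to ℕ using (by omega)
  have hle : n ≤ D := by exact_mod_cast hle
  obtain ⟨p, hp⟩ := (Nat.modEq_iff_dvd' hle).1 (Int.natCast_modEq_iff.1 hmod)
  have hD : n + p * q = D := by rw [mul_comm, ← hp, Nat.add_sub_cancel' hle]
  obtain ⟨h, hI, hh, h0⟩ := mem_ordersOf_iff.1 (hD ▸ add_mul_mem_ordersOf hn p)
  have hsum := errorSum_mul_eq hv.residual_eq_zero hh
  rw [hv.residual_eq_one, mul_one, errorSum_eq_zero (Ideal.mul_mem_right _ _ hI)] at hsum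
  exact h0 hsum.symm

lemma KeyInvariant.rhoInt_le_sigma {m : ℕ} {st : State q F} (h : KeyInvariant e m st)
    (i : Fin q) : rhoInt (st.f i) ≤ sigma e i := by
  obtain ⟨v, -, haux⟩ := h.exists_isAuxiliary i
  obtain ⟨hσ, hσi⟩ := (isLeast_sigma e i).1
  have hmod : (sigma e i : ℤ) ≡ rhoInt (st.f i) [ZMOD q] :=
    (Int.natCast_modEq_iff.2 hσi).trans (yExp_eq_iff.1 (h.yExp_rhoInt i)).symm
  have hlt := haux.lt_of_mem_ordersOf hσ (hmod.trans (by simp [Int.ModEq]))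
  by_contra! hgt
  have := Int.le_of_dvd (by omega) hmod.dvd
  omega

lemma run_f_mem_locatorIdeal {m : ℕ} (hm : sigmaMax e + deltaMax e < m) (i : Fin q) :
    (run e m).f i ∈ locatorIdeal e := by
  obtain ⟨u, hu, hloc⟩ := (keyInvariant_run e m).exists_isLocator i
  have hfst : u.1 = (run e m).f i := congrArg Prod.fst hu
  have hd := (keyInvariant_run e m).rhoInt_le_sigma i
  have hσ := sigma_le_sigmaMax (e := e) i
  have hδ : ∀ n ∈ footprint e, n ≤ deltaMax e := fun _ => le_csSup bddAbove_footprint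
  exact hfst ▸ hloc.mem_locatorIdeal hδ (by omega)

variable (e) in
lemma run_solvesKeyEquation (i : Fin q) :
    SolvesKeyEquation e ((run e (lastIteration e + 1)).f i)
      ((run e (lastIteration e + 1)).φ i) := by
  set m := lastIteration e + 1 with hm
  obtain ⟨u, hu, hloc⟩ := (keyInvariant_run e m).exists_isLocator i
  have hfst : u.1 = (run e m).f i := congrArg Prod.fst hu
  have hd := (keyInvariant_run e m).rhoInt_le_sigma i
  have hσ := sigma_le_sigmaMax (e := e) i
  have hδ := le_max_left (deltaMax e) (q ^ 2 - q - 1)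
  have hq := le_max_right (deltaMax e) (q ^ 2 - q - 1)
  rw [lastIteration] at hm
  have hmem : u.1 ∈ locatorIdeal e := hfst ▸ run_f_mem_locatorIdeal (by omega) i
  have hq2 : ((q ^ 2 : ℕ) : ℤ) = (q : ℤ) ^ 2 := Nat.cast_pow q 2
  have hkey := hloc.solvesKeyEquation hmem (by omega)
  rwa [hu] at hkey

end Correctness

end

end Hermitian

theorem mainTheorem7_general {q : ℕ} [Fact (IsPrimePow q)] {F : Type*} [Field F] [Fintype F]
    (e : Hermitian.Point q F → F) :
    (∀ i : Fin q, IsLeast (Hermitian.residueOrders e i) (Hermitian.sigma e i)) ∧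
    (e ≠ 0 → IsGreatest (Hermitian.footprint e) (Hermitian.deltaMax e)) ∧
    (∀ m : ℕ, Hermitian.sigmaMax e + Hermitian.deltaMax e < m →
      ∀ i : Fin q, (Hermitian.run e m).f i ∈ Hermitian.locatorIdeal e) ∧
    (∀ i : Fin q, Hermitian.SolvesKeyEquation e
      ((Hermitian.run e (Hermitian.lastIteration e + 1)).f i)
      ((Hermitian.run e (Hermitian.lastIteration e + 1)).φ i)) :=
  ⟨Hermitian.isLeast_sigma e, Hermitian.isGreatest_deltaMax,
    fun _ hm i => Hermitian.run_f_mem_locatorIdeal hm i, Hermitian.run_solvesKeyEquation e⟩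

theorem mainTheorem7 {q : ℕ} [Fact (IsPrimePow q)] {F : Type*} [Field F] [Fintype F]
    (hF : Fintype.card F = q ^ 2) (e : Hermitian.Point q F → F) :
    (∀ i : Fin q, IsLeast (Hermitian.residueOrders e i) (Hermitian.sigma e i)) ∧
    (e ≠ 0 → IsGreatest (Hermitian.footprint e) (Hermitian.deltaMax e)) ∧
    (∀ m : ℕ, Hermitian.sigmaMax e + Hermitian.deltaMax e < m →
      ∀ i : Fin q, (Hermitian.run e m).f i ∈ Hermitian.locatorIdeal e) ∧
    (∀ i : Fin q, Hermitian.SolvesKeyEquation e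
      ((Hermitian.run e (Hermitian.lastIteration e + 1)).f i)
      ((Hermitian.run e (Hermitian.lastIteration e + 1)).φ i)) :=
  mainTheorem7_general e
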